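/- **The meta-logic.** Let $FO\lambda^{\Delta\mathbb N}$ be the following intuitionistic sequent calculus. Terms are simply typed $\lambda$-terms up to $\alpha\beta\eta$-conversion, over ground types that include $nt, i, atm, prp, atmlst$, with infinitely many variables of each type. Formulas are built from atoms $p\,\bar t$ by $\bot,\top,\land,\lor,\supset,\forall_\tau,\exists_\tau$, where $\tau$ is any simple type not involving the type $o$ of formulas. A sequent $\Gamma\longrightarrow B$ has a finite multiset $\Gamma$ and a single formula $B$. The rules are the usual left and right rules for the connectives, initial sequents $A,\Gamma\longrightarrow A$ for atomic $A$, contraction, cut; the rules for $nat$: $$\frac{}{\Gamma\longrightarrow nat\,z}\qquad\frac{\Gamma\longrightarrow nat\,I}{\Gamma\longrightarrow nat\,(s\,I)}\qquad\frac{\longrightarrow B\,z\quad B\,j\longrightarrow B\,(s\,j)\quad B\,I,\Gamma\longrightarrow C}{nat\,I,\Gamma\longrightarrow C}\ (j\text{ not free in }B);$$ and, relative to a *definition* $\mathcal D$, i.e. a possibly infinite set of clauses $\forall\bar x[p\,\bar t\triangleq B]$ without free variables, the rules for atoms with a predicate other than $nat$: from $\Gamma\longrightarrow B\theta$ infer $\Gamma\longrightarrow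 p\,\bar u$ if $p\,\bar u=(p\,\bar t)\theta$ for some clause; and infer $p\,\bar u,\Gamma\longrightarrow C$ from all the sequents $B\theta,\Gamma\theta\longrightarrow C\theta$, where $\theta$ runs through a complete set of unifiers of $p\,\bar u$ and the head of a clause, for every clause of $\mathcal D$. Each predicate $p$ has a level $\mathrm{lvl}(p)\in\mathbb N$, extended to formulas by $\mathrm{lvl}(p\,\bar t)=\mathrm{lvl}(p)$, $\mathrm{lvl}(\top)=\mathrm{lvl}(\bot)=0$, maxima for $\land,\lor$, $\mathrm{lvl}(B\supset C)=\max(\mathrm{lvl}(B)+1,\mathrm{lvl}(C))$, and no change under quantifiers; every clause $\forall\bar x[p\,\bar t\triangleq B]$ of a definition must satisfy $\mathrm{lvl}(B)\le\mathrm{lvl}(p)$. **The encoding.** There are constants $z:nt$, $s:nt\to nt$, $nil:atmlst$, $::\;:atm\to atmlst\to atmlst$, $\langle\cdot\rangle:atm\to prp$, $tt:prp$, $\&:prp\to prp\to prp$, $\Rightarrow\;:atm\to prp\to prp$, $\bigwedge_i:(i\to prp)\to prp$, and arbitrary further constants. $\mathcal D(nat)$ consists of the clauses $$I=I\triangleq\top,\quad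 sum\,z\,J\,J\triangleq nat\,J,\quad sum\,(s\,I)\,J\,(s\,K)\triangleq sum\,I\,J\,K,\quad z<s\,J\triangleq nat\,J,\quad s\,I<s\,J\triangleq I<J,\quad I\le I\triangleq\top,\quad I\le J\triangleq I<J.$$ $\mathcal D_{list}(atm)$ consists of $$\begin{aligned}&length\,nil\,z\triangleq\top,\quad length\,(X::L)\,(s\,I)\triangleq length\,L\,I,\quad list\,L\triangleq\exists i(nat\,i\land length\,L\,i),\\&element\,X\,(X::L)\triangleq\top,\quad element\,X\,(Y::L)\triangleq element\,X\,L,\quad split\,nil\,nil\,nil\triangleq\top,\\&split\,(X::L_1)\,(X::L_2)\,L_3\triangleq split\,L_1\,L_2\,L_3,\quad split\,(X::L_1)\,L_2\,(X::L_3)\triangleq split\,L_1\,L_2\,L_3,\\&permute\,nil\,nil\triangleq\top,\quad permute\,(X::L_1)\,L_2\triangleq\exists l(split\,L_2\,(X::nil)\,l\land permute\,L_1\,l).\end{aligned}$$ $\mathcal D(intuit)$ consists of $$\begin{aligned}&seq_I\,(A'::L)\,\langle A\rangle\triangleq element\,A\,(A'::L),\quad seq_I\,L\,tt\triangleq\top,\quad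 seq_{s I}\,L\,(B\,\&\,C)\triangleq seq_I\,L\,B\land seq_I\,L\,C,\\&seq_{sI}\,L\,(A\Rightarrow B)\triangleq seq_I\,(A::L)\,B,\quad seq_{sI}\,L\,(\textstyle\bigwedge_iB)\triangleq\forall_ix\;seq_I\,L\,(B\,x),\\&seq_{sI}\,L\,\langle A\rangle\triangleq\exists b(prog\,A\,b\land seq_I\,L\,b).\end{aligned}$$ Write $prv_L\,B$ for $\exists i(nat\,i\land seq_i\,L\,B)$. **The translation.** Formulas of the object-level intuitionistic logic have the terms of type $atm$ as atomic formulas and quantifiers over simply typed terms. A term $B$ of type $prp$ built with the constants above translates to a formula $[\![B]\!]$: $[\![\langle A\rangle]\!]=A$, $[\![tt]\!]=\top$, $[\![B\,\&\,C]\!]=[\![B]\!]\land[\![C]\!]$, $[\![A\Rightarrow B]\!]=A\Rightarrow[\![B]\!]$, $[\![\bigwedge_i\lambda x.B]\!]=\bigwedge_ix.[\![B]\!]$. A term $L=A_1::\cdots::A_m::nil$ of type $atmlst$ translates to the multiset $[\![L]\!]=\{A_1,\dots,A_m\}$. **Theorem (Adequacy of Encoding Intuitionistic Logic).** Let $n\ge0$,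 let $\mathcal D(prog)=\{\forall\bar x_1[prog\,A_1\,G_1\triangleq\top],\dots,\forall\bar x_n[prog\,A_n\,G_n\triangleq\top]\}$, where each $G_k$ has a translation and the variables $\bar x_k$ have any simple types, and let $\mathcal P$ be the set of the formulas $\bigwedge\bar x_k([\![G_k]\!]\Rightarrow A_k)$, $1\le k\le n$. Let $\mathcal D$ be a definition that extends $\mathcal D(nat)\cup\mathcal D_{list}(atm)\cup\mathcal D(intuit)\cup\mathcal D(prog)$ by clauses whose heads have predicates other than $nat$, $seq$, $element$, $prog$. Let $L$ and $B$ be terms of types $atmlst$ and $prp$ that have translations. Then $\longrightarrow prv_L\,B$ is derivable in $FO\lambda^{\Delta\mathbb N}$ with definition $\mathcal D$ if and only if $[\![B]\!]$ is an intuitionistic consequence of $[\![L]\!]\cup\mathcal P$. -/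

import Mathlib

universe u

namespace FOLambda

/-! ## Types, signatures and simply typed terms -/

/-- Ground types: natural numbers `nt`, object-level terms `i`, object-level atoms `atm`,
object-level goal formulas `prp`, lists of atoms `atmlst`, and any further ground types.
The type `o` of formulas is not among them, so no quantified type contains `o`. -/
inductive Base (U : Type u) : Type u
  | nt | i | atm | prp | atmlst
  | other (b : U)

/-- Simple types over the ground types. -/
inductive Ty (U : Type u) : Type u
  | base (b : Base U)
  | arr (σ τ : Ty U)

namespace Ty
variable {U : Type u}
abbrev nt : Ty U := .base .nt
abbrev i : Ty U := .base .i
abbrev atm : Ty U := .base .atm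
abbrev prp : Ty U := .base .prp
abbrev atmlst : Ty U := .base .atmlst
end Ty

/-- The part of the language that is left open: further ground types, further typed constants
(such as the object-level function and predicate symbols) and further predicate symbols,
each with the list of its argument types. -/
structure Signature where
  Ground : Type u
  Con : Type u
  conTy : Con → Ty Ground
  Prd : Type u
  prdTy : Prd → List (Ty Ground)

/-- The typed constants. -/
inductive Const (S : Signature.{u}) : Ty S.Ground → Type u
  | zero : Const S .nt
  | suc : Const S (.arr .nt .nt)
  | nil : Const S .atmlst
  | cons : Const S (.arr .atm (.arr .atmlst .atmlst))
  | atom : Const S (.arr .atm .prp)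
  | tt : Const S .prp
  | and : Const S (.arr .prp (.arr .prp .prp))
  | imp : Const S (.arr .atm (.arr .prp .prp))
  | all : Const S (.arr (.arr .i .prp) .prp)
  | other (c : S.Con) : Const S (S.conTy c)

/-- Typed de Bruijn indices into a context. -/
inductive Var {T : Type u} : List T → T → Type u
  | zero {Γ : List T} {τ : T} : Var (τ :: Γ) τ
  | succ {Γ : List T} {σ τ : T} (x : Var Γ τ) : Var (σ :: Γ) τ

/-- Simply typed `λ`-terms whose indices refer to the context `Γ`. For every type `τ` and every
`n : N` there is moreover a named variable `free τ n` of type `τ`. Sequents use `N = ℕ`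
(infinitely many variables of each type), closed syntax uses `N = Empty`. -/
inductive Tm (S : Signature.{u}) (N : Type) : List (Ty S.Ground) → Ty S.Ground → Type u
  | bvar {Γ : List (Ty S.Ground)} {τ : Ty S.Ground} (x : Var Γ τ) : Tm S N Γ τ
  | free {Γ : List (Ty S.Ground)} (τ : Ty S.Ground) (n : N) : Tm S N Γ τ
  | const {Γ : List (Ty S.Ground)} {τ : Ty S.Ground} (c : Const S τ) : Tm S N Γ τ
  | app {Γ : List (Ty S.Ground)} {σ τ : Ty S.Ground}
      (t : Tm S N Γ (.arr σ τ)) (t' : Tm S N Γ σ) : Tm S N Γ τ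
  | lam {Γ : List (Ty S.Ground)} {σ τ : Ty S.Ground}
      (t : Tm S N (σ :: Γ) τ) : Tm S N Γ (.arr σ τ)

section Terms
variable {S : Signature.{u}} {N N' : Type}

/-- Assignments of terms to the indices of a context. -/
abbrev Assign (S : Signature.{u}) (N : Type) (Γ Δ : List (Ty S.Ground)) : Type u :=
  ∀ τ : Ty S.Ground, Var Γ τ → Tm S N Δ τ

/-- Assignments of terms to the named variables. -/
abbrev NameSubst (S : Signature.{u}) (N N' : Type) (Δ : List (Ty S.Ground)) : Type u :=
  ∀ τ : Ty S.Ground, N → Tm S N' Δ τ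

def Var.lift {T : Type u} {Γ Δ : List T} (ρ : ∀ τ : T, Var Γ τ → Var Δ τ) (σ : T) :
    ∀ τ : T, Var (σ :: Γ) τ → Var (σ :: Δ) τ
  | _, .zero => .zero
  | _, .succ x => .succ (ρ _ x)

def Tm.rename {Γ Δ : List (Ty S.Ground)} {τ : Ty S.Ground}
    (ρ : ∀ τ : Ty S.Ground, Var Γ τ → Var Δ τ) : Tm S N Γ τ → Tm S N Δ τ
  | .bvar x => .bvar (ρ _ x)
  | .free τ n => .free τ n
  | .const c => .const c
  | .app t t' => .app (t.rename ρ) (t'.rename ρ)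
  | .lam t => .lam (t.rename (Var.lift ρ _))

/-- Weakening by one index. -/
def Tm.wk {Γ : List (Ty S.Ground)} {σ τ : Ty S.Ground} (t : Tm S N Γ τ) : Tm S N (σ :: Γ) τ :=
  t.rename fun _ x => .succ x

def NameSubst.wk {Δ : List (Ty S.Ground)} (θ : NameSubst S N N' Δ) (σ : Ty S.Ground) :
    NameSubst S N N' (σ :: Δ) :=
  fun τ n => (θ τ n).wk

def Assign.lift {Γ Δ : List (Ty S.Ground)} (η : Assign S N Γ Δ) (σ : Ty S.Ground) :
    Assign S N (σ :: Γ) (σ :: Δ)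
  | _, .zero => .bvar .zero
  | _, .succ x => (η _ x).wk

/-- Simultaneous capture-avoiding substitution for the named variables (by `θ`) and the
indices (by `η`). -/
def Tm.bind {Γ Δ : List (Ty S.Ground)} {τ : Ty S.Ground}
    (θ : NameSubst S N N' Δ) (η : Assign S N' Γ Δ) : Tm S N Γ τ → Tm S N' Δ τ
  | .bvar x => η _ x
  | .free τ n => θ τ n
  | .const c => .const c
  | .app t t' => .app (t.bind θ η) (t'.bind θ η)
  | .lam t => .lam (t.bind (θ.wk _) (η.lift _))

/-- The assignment that replaces index `0` by `t` and lowers the other indices. -/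
def Assign.single {Γ : List (Ty S.Ground)} {σ : Ty S.Ground} (t : Tm S N Γ σ) :
    Assign S N (σ :: Γ) Γ
  | _, .zero => t
  | _, .succ x => .bvar x

/-- The assignment on the empty context. -/
def Assign.none {Δ : List (Ty S.Ground)} : Assign S N [] Δ := fun _ x => nomatch x

/-- `b[t/x]` for terms. -/
def Tm.inst {Γ : List (Ty S.Ground)} {σ τ : Ty S.Ground} (b : Tm S N (σ :: Γ) τ)
    (t : Tm S N Γ σ) : Tm S N Γ τ :=
  b.bind (fun τ n => .free τ n) (Assign.single t)

/-- The named variable `n` of type `τ` occurs in the term. -/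
def Tm.Occurs (τ : Ty S.Ground) (n : N) {Γ : List (Ty S.Ground)} {τ' : Ty S.Ground} :
    Tm S N Γ τ' → Prop
  | .bvar _ => False
  | .free τ'' m => τ'' = τ ∧ m = n
  | .const _ => False
  | .app t t' => t.Occurs τ n ∨ t'.Occurs τ n
  | .lam t => t.Occurs τ n

/-- `βη`-convertibility (`α`-conversion is built into de Bruijn indices). -/
inductive Tm.Conv : {Γ : List (Ty S.Ground)} → {τ : Ty S.Ground} →
    Tm S N Γ τ → Tm S N Γ τ → Prop
  | refl {Γ : List (Ty S.Ground)} {τ : Ty S.Ground} (t : Tm S N Γ τ) : Conv t t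
  | symm {Γ : List (Ty S.Ground)} {τ : Ty S.Ground} {t t' : Tm S N Γ τ} :
      Conv t t' → Conv t' t
  | trans {Γ : List (Ty S.Ground)} {τ : Ty S.Ground} {t t' t'' : Tm S N Γ τ} :
      Conv t t' → Conv t' t'' → Conv t t''
  | app {Γ : List (Ty S.Ground)} {σ τ : Ty S.Ground} {t t' : Tm S N Γ (.arr σ τ)}
      {r r' : Tm S N Γ σ} : Conv t t' → Conv r r' → Conv (.app t r) (.app t' r')
  | lam {Γ : List (Ty S.Ground)} {σ τ : Ty S.Ground} {t t' : Tm S N (σ :: Γ) τ} :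
      Conv t t' → Conv (.lam t) (.lam t')
  | beta {Γ : List (Ty S.Ground)} {σ τ : Ty S.Ground} (t : Tm S N (σ :: Γ) τ)
      (r : Tm S N Γ σ) : Conv (.app (.lam t) r) (t.inst r)
  | eta {Γ : List (Ty S.Ground)} {σ τ : Ty S.Ground} (t : Tm S N Γ (.arr σ τ)) :
      Conv (.lam (.app t.wk (.bvar .zero))) t

/-- Lists of terms of given types. -/
inductive Tms (S : Signature.{u}) (N : Type) (Γ : List (Ty S.Ground)) :
    List (Ty S.Ground) → Type u
  | nil : Tms S N Γ []
  | cons {τ : Ty S.Ground} {τs : List (Ty S.Ground)} (t : Tm S N Γ τ) (ts : Tms S N Γ τs) :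
      Tms S N Γ (τ :: τs)

def Tms.bind {Γ Δ τs : List (Ty S.Ground)} (θ : NameSubst S N N' Δ) (η : Assign S N' Γ Δ) :
    Tms S N Γ τs → Tms S N' Δ τs
  | .nil => .nil
  | .cons t ts => .cons (t.bind θ η) (ts.bind θ η)

def Tms.Occurs (τ : Ty S.Ground) (n : N) {Γ τs : List (Ty S.Ground)} : Tms S N Γ τs → Prop
  | .nil => False
  | .cons t ts => t.Occurs τ n ∨ ts.Occurs τ n

inductive Tms.Conv {Γ : List (Ty S.Ground)} : {τs : List (Ty S.Ground)} →
    Tms S N Γ τs → Tms S N Γ τs → Prop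
  | nil : Conv .nil .nil
  | cons {τ : Ty S.Ground} {τs : List (Ty S.Ground)} {t t' : Tm S N Γ τ} {ts ts' : Tms S N Γ τs} :
      t.Conv t' → Conv ts ts' → Conv (.cons t ts) (.cons t' ts')

end Terms

/-! ## Formulas

Formulas over a vocabulary `P` of predicate symbols with argument types `ar`. The same syntax
serves for the meta-logic and for the object logic; only the vocabularies differ. -/

inductive Form (S : Signature.{u}) {P : Type u} (ar : P → List (Ty S.Ground)) (N : Type) :
    List (Ty S.Ground) → Type u
  | atom {Γ : List (Ty S.Ground)} (p : P) (ts : Tms S N Γ (ar p)) : Form S ar N Γ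
  | top {Γ : List (Ty S.Ground)} : Form S ar N Γ
  | bot {Γ : List (Ty S.Ground)} : Form S ar N Γ
  | and {Γ : List (Ty S.Ground)} (B C : Form S ar N Γ) : Form S ar N Γ
  | or {Γ : List (Ty S.Ground)} (B C : Form S ar N Γ) : Form S ar N Γ
  | imp {Γ : List (Ty S.Ground)} (B C : Form S ar N Γ) : Form S ar N Γ
  | all {Γ : List (Ty S.Ground)} (τ : Ty S.Ground) (B : Form S ar N (τ :: Γ)) : Form S ar N Γ
  | ex {Γ : List (Ty S.Ground)} (τ : Ty S.Ground) (B : Form S ar N (τ :: Γ)) : Form S ar N Γ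

section Formulas
variable {S : Signature.{u}} {P : Type u} {ar : P → List (Ty S.Ground)} {N N' : Type}

def Form.bind {Γ Δ : List (Ty S.Ground)} (θ : NameSubst S N N' Δ) (η : Assign S N' Γ Δ) :
    Form S ar N Γ → Form S ar N' Δ
  | .atom p ts => .atom p (ts.bind θ η)
  | .top => .top
  | .bot => .bot
  | .and B C => .and (B.bind θ η) (C.bind θ η)
  | .or B C => .or (B.bind θ η) (C.bind θ η)
  | .imp B C => .imp (B.bind θ η) (C.bind θ η)
  | .all τ B => .all τ (B.bind (θ.wk τ) (η.lift τ))
  | .ex τ B => .ex τ (B.bind (θ.wk τ) (η.lift τ))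

/-- `B[t/x]` for formulas. -/
def Form.inst {Γ : List (Ty S.Ground)} {σ : Ty S.Ground} (B : Form S ar N (σ :: Γ))
    (t : Tm S N Γ σ) : Form S ar N Γ :=
  B.bind (fun τ n => .free τ n) (Assign.single t)

/-- The named variable `n` of type `τ` occurs in the formula. -/
def Form.Occurs (τ : Ty S.Ground) (n : N) {Γ : List (Ty S.Ground)} : Form S ar N Γ → Prop
  | .atom _ ts => ts.Occurs τ n
  | .top => False
  | .bot => False
  | .and B C => B.Occurs τ n ∨ C.Occurs τ n
  | .or B C => B.Occurs τ n ∨ C.Occurs τ n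
  | .imp B C => B.Occurs τ n ∨ C.Occurs τ n
  | .all _ B => B.Occurs τ n
  | .ex _ B => B.Occurs τ n

/-- `βη`-convertibility of formulas. -/
inductive Form.Conv : {Γ : List (Ty S.Ground)} → Form S ar N Γ → Form S ar N Γ → Prop
  | atom {Γ : List (Ty S.Ground)} (p : P) {ts ts' : Tms S N Γ (ar p)} :
      ts.Conv ts' → Conv (.atom p ts) (.atom p ts')
  | top {Γ : List (Ty S.Ground)} : Conv (.top (Γ := Γ)) .top
  | bot {Γ : List (Ty S.Ground)} : Conv (.bot (Γ := Γ)) .bot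
  | and {Γ : List (Ty S.Ground)} {B B' C C' : Form S ar N Γ} :
      Conv B B' → Conv C C' → Conv (.and B C) (.and B' C')
  | or {Γ : List (Ty S.Ground)} {B B' C C' : Form S ar N Γ} :
      Conv B B' → Conv C C' → Conv (.or B C) (.or B' C')
  | imp {Γ : List (Ty S.Ground)} {B B' C C' : Form S ar N Γ} :
      Conv B B' → Conv C C' → Conv (.imp B C) (.imp B' C')
  | all {Γ : List (Ty S.Ground)} (τ : Ty S.Ground) {B B' : Form S ar N (τ :: Γ)} :
      Conv B B' → Conv (.all τ B) (.all τ B')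
  | ex {Γ : List (Ty S.Ground)} (τ : Ty S.Ground) {B B' : Form S ar N (τ :: Γ)} :
      Conv B B' → Conv (.ex τ B) (.ex τ B')

/-- The level of a formula, given the levels of the predicate symbols. -/
def Form.level (lvl : P → ℕ) {Γ : List (Ty S.Ground)} : Form S ar N Γ → ℕ
  | .atom p _ => lvl p
  | .top => 0
  | .bot => 0
  | .and B C => max (B.level lvl) (C.level lvl)
  | .or B C => max (B.level lvl) (C.level lvl)
  | .imp B C => max (B.level lvl + 1) (C.level lvl)
  | .all _ B => B.level lvl
  | .ex _ B => B.level lvl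

/-- Universal closure: the quantifier prefix over all indices of the context. -/
def Form.close : (Γ : List (Ty S.Ground)) → Form S ar N Γ → Form S ar N []
  | [], B => B
  | τ :: Γ, B => Form.close Γ (.all τ B)

/-- A formula without named variables, read as a formula that may have some. -/
def Form.ofClosed {Γ : List (Ty S.Ground)} (B : Form S ar Empty Γ) : Form S ar N Γ :=
  B.bind (fun _ n => n.elim) (fun _ x => .bvar x)

end Formulas

/-! ## The meta-logic -/

/-- The predicate symbols of the meta-logic. -/
inductive Pred (S : Signature.{u}) : Type u
  | nat | eq | lt | le | sum
  | length | list | element | split | permute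
  | seq | prog
  | other (p : S.Prd)

def Pred.arity {S : Signature.{u}} : Pred S → List (Ty S.Ground)
  | .nat => [.nt]
  | .eq => [.nt, .nt]
  | .lt => [.nt, .nt]
  | .le => [.nt, .nt]
  | .sum => [.nt, .nt, .nt]
  | .length => [.atmlst, .nt]
  | .list => [.atmlst]
  | .element => [.atm, .atmlst]
  | .split => [.atmlst, .atmlst, .atmlst]
  | .permute => [.atmlst, .atmlst]
  | .seq => [.nt, .atmlst, .prp]
  | .prog => [.atm, .prp]
  | .other p => S.prdTy p

/-- Formulas of the meta-logic. -/
abbrev MForm (S : Signature.{u}) (N : Type) (Γ : List (Ty S.Ground)) : Type u :=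
  Form S (Pred.arity (S := S)) N Γ

/-- A definitional clause `∀ x̄ [p t̄ ≜ B]`; `ctx` lists the types of `x̄`. There are no named
variables in a clause. That each variable of the body also occurs in the head is not demanded:
all such clauses are covered, and others too. -/
structure Clause (S : Signature.{u}) where
  ctx : List (Ty S.Ground)
  pred : Pred S
  args : Tms S Empty ctx pred.arity
  body : MForm S Empty ctx

section Derivations
variable {S : Signature.{u}}

def Clause.head (c : Clause S) : MForm S Empty c.ctx := .atom c.pred c.args

/-- The instance of a clause formula under an assignment of terms to the clause variables. -/
def Clause.formInst {Γ : List (Ty S.Ground)} (B : MForm S Empty Γ) (η : Assign S ℕ Γ []) :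
    MForm S ℕ [] :=
  B.bind (fun _ n => n.elim) η

/-- Substitution for the named variables of a formula. -/
def MForm.subst (θ : NameSubst S ℕ ℕ []) (B : MForm S ℕ []) : MForm S ℕ [] :=
  B.bind θ Assign.none

def Tm.subst (θ : NameSubst S ℕ ℕ []) {τ : Ty S.Ground} (t : Tm S ℕ [] τ) : Tm S ℕ [] τ :=
  t.bind θ Assign.none

/-- A substitution for the named variables together with the variables of the clause `c`;
the two kinds of variables are distinct by construction. -/
structure ClauseSubst (c : Clause S) where
  names : NameSubst S ℕ ℕ []
  vars : Assign S ℕ c.ctx []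

/-- `π` unifies the formula `A` with the head of the clause `c`. -/
def IsUnifier (A : MForm S ℕ []) (c : Clause S) (π : ClauseSubst c) : Prop :=
  (A.subst π.names).Conv (Clause.formInst c.head π.vars)

/-- A complete set of unifiers of `A` and the head of `c`: it consists of unifiers, and every
unifier is, up to `βη`-conversion, a member followed by some substitution. -/
def IsCSU (A : MForm S ℕ []) (c : Clause S) (U : Set (ClauseSubst c)) : Prop :=
  (∀ π ∈ U, IsUnifier A c π) ∧
  ∀ ρ : ClauseSubst c, IsUnifier A c ρ → ∃ π ∈ U, ∃ σ : NameSubst S ℕ ℕ [],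
    (∀ (τ : Ty S.Ground) (n : ℕ), (ρ.names τ n).Conv ((π.names τ n).subst σ)) ∧
    (∀ (τ : Ty S.Ground) (x : Var c.ctx τ), (ρ.vars τ x).Conv ((π.vars τ x).subst σ))

/-- Zero and successor. -/
def zeroT {N : Type} {Γ : List (Ty S.Ground)} : Tm S N Γ .nt := .const .zero
def sucT {N : Type} {Γ : List (Ty S.Ground)} (t : Tm S N Γ .nt) : Tm S N Γ .nt :=
  .app (.const .suc) t

/-- The atomic formula `nat t`. -/
def natF {N : Type} {Γ : List (Ty S.Ground)} (t : Tm S N Γ .nt) : MForm S N Γ :=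
  .atom .nat (.cons t .nil)

/-- The sequent `Γ ⟶ B` is derivable in the meta-logic with the definition `D`. Formulas are
identified up to `βη`-conversion, which is the rule `conv`. The predicate `nat` is not a defined
predicate: it has rules of its own, and the definition rules do not apply to it. -/
inductive Derivable (D : Set (Clause S)) : Multiset (MForm S ℕ []) → MForm S ℕ [] → Prop
  | conv {Γ Γ' : Multiset (MForm S ℕ [])} {B B' : MForm S ℕ []} :
      Multiset.Rel Form.Conv Γ Γ' → B.Conv B' → Derivable D Γ B → Derivable D Γ' B'
  | botL {Γ : Multiset (MForm S ℕ [])} {B : MForm S ℕ []} : Derivable D (.bot ::ₘ Γ) B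
  | topR {Γ : Multiset (MForm S ℕ [])} : Derivable D Γ .top
  | andL₁ {Γ : Multiset (MForm S ℕ [])} {B C E : MForm S ℕ []} :
      Derivable D (B ::ₘ Γ) E → Derivable D (.and B C ::ₘ Γ) E
  | andL₂ {Γ : Multiset (MForm S ℕ [])} {B C E : MForm S ℕ []} :
      Derivable D (C ::ₘ Γ) E → Derivable D (.and B C ::ₘ Γ) E
  | andR {Γ : Multiset (MForm S ℕ [])} {B C : MForm S ℕ []} :
      Derivable D Γ B → Derivable D Γ C → Derivable D Γ (.and B C)
  | orL {Γ : Multiset (MForm S ℕ [])} {B C E : MForm S ℕ []} :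
      Derivable D (B ::ₘ Γ) E → Derivable D (C ::ₘ Γ) E → Derivable D (.or B C ::ₘ Γ) E
  | orR₁ {Γ : Multiset (MForm S ℕ [])} {B C : MForm S ℕ []} :
      Derivable D Γ B → Derivable D Γ (.or B C)
  | orR₂ {Γ : Multiset (MForm S ℕ [])} {B C : MForm S ℕ []} :
      Derivable D Γ C → Derivable D Γ (.or B C)
  | impL {Γ : Multiset (MForm S ℕ [])} {B C E : MForm S ℕ []} :
      Derivable D Γ B → Derivable D (C ::ₘ Γ) E → Derivable D (.imp B C ::ₘ Γ) E
  | impR {Γ : Multiset (MForm S ℕ [])} {B C : MForm S ℕ []} :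
      Derivable D (B ::ₘ Γ) C → Derivable D Γ (.imp B C)
  | allL {Γ : Multiset (MForm S ℕ [])} {τ : Ty S.Ground} {B : MForm S ℕ [τ]} {C : MForm S ℕ []}
      (t : Tm S ℕ [] τ) : Derivable D (B.inst t ::ₘ Γ) C → Derivable D (.all τ B ::ₘ Γ) C
  | allR {Γ : Multiset (MForm S ℕ [])} {τ : Ty S.Ground} {B : MForm S ℕ [τ]} (y : ℕ) :
      (∀ F ∈ Γ, ¬ F.Occurs τ y) → ¬ B.Occurs τ y →
      Derivable D Γ (B.inst (.free τ y)) → Derivable D Γ (.all τ B)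
  | exL {Γ : Multiset (MForm S ℕ [])} {τ : Ty S.Ground} {B : MForm S ℕ [τ]} {C : MForm S ℕ []}
      (y : ℕ) :
      (∀ F ∈ Γ, ¬ F.Occurs τ y) → ¬ B.Occurs τ y → ¬ C.Occurs τ y →
      Derivable D (B.inst (.free τ y) ::ₘ Γ) C → Derivable D (.ex τ B ::ₘ Γ) C
  | exR {Γ : Multiset (MForm S ℕ [])} {τ : Ty S.Ground} {B : MForm S ℕ [τ]} (t : Tm S ℕ [] τ) :
      Derivable D Γ (B.inst t) → Derivable D Γ (.ex τ B)
  | init {Γ : Multiset (MForm S ℕ [])} (p : Pred S) (ts : Tms S ℕ [] p.arity) :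
      Derivable D (.atom p ts ::ₘ Γ) (.atom p ts)
  | contrL {Γ : Multiset (MForm S ℕ [])} {B C : MForm S ℕ []} :
      Derivable D (B ::ₘ B ::ₘ Γ) C → Derivable D (B ::ₘ Γ) C
  | cut {Δ Γ : Multiset (MForm S ℕ [])} {B C : MForm S ℕ []} :
      Derivable D Δ B → Derivable D (B ::ₘ Γ) C → Derivable D (Δ + Γ) C
  | natR_zero {Γ : Multiset (MForm S ℕ [])} : Derivable D Γ (natF zeroT)
  | natR_suc {Γ : Multiset (MForm S ℕ [])} {I : Tm S ℕ [] .nt} :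
      Derivable D Γ (natF I) → Derivable D Γ (natF (sucT I))
  | natL {Γ : Multiset (MForm S ℕ [])} {I : Tm S ℕ [] .nt} {C : MForm S ℕ []}
      (B : MForm S ℕ [.nt]) (j : ℕ) : ¬ B.Occurs .nt j →
      Derivable D 0 (B.inst zeroT) →
      Derivable D {B.inst (.free .nt j)} (B.inst (sucT (.free .nt j))) →
      Derivable D (B.inst I ::ₘ Γ) C → Derivable D (natF I ::ₘ Γ) C
  | defR {Γ : Multiset (MForm S ℕ [])} (p : Pred S) (us : Tms S ℕ [] p.arity) (c : Clause S)
      (η : Assign S ℕ c.ctx []) : p ≠ .nat → c ∈ D →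
      (Form.atom p us : MForm S ℕ []).Conv (Clause.formInst c.head η) →
      Derivable D Γ (Clause.formInst c.body η) → Derivable D Γ (.atom p us)
  | defL {Γ : Multiset (MForm S ℕ [])} {C : MForm S ℕ []} (p : Pred S)
      (us : Tms S ℕ [] p.arity) (U : (c : Clause S) → Set (ClauseSubst c)) : p ≠ .nat →
      (∀ c ∈ D, IsCSU (.atom p us) c (U c)) →
      (∀ c ∈ D, ∀ π ∈ U c,
        Derivable D (Clause.formInst c.body π.vars ::ₘ Γ.map (MForm.subst π.names))
          (C.subst π.names)) →
      Derivable D (.atom p us ::ₘ Γ) C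

end Derivations

/-! ## The definitions of the predicates -/

section Definitions
variable {S : Signature.{u}} {N : Type} {Γ : List (Ty S.Ground)}

def nilT : Tm S N Γ .atmlst := .const .nil
def consT (a : Tm S N Γ .atm) (l : Tm S N Γ .atmlst) : Tm S N Γ .atmlst :=
  .app (.app (.const .cons) a) l
/-- The coercion of atoms to goal formulas. -/
def atomT (a : Tm S N Γ .atm) : Tm S N Γ .prp := .app (.const .atom) a
def ttT : Tm S N Γ .prp := .const .tt
def andT (b c : Tm S N Γ .prp) : Tm S N Γ .prp := .app (.app (.const .and) b) c
def impT (a : Tm S N Γ .atm) (b : Tm S N Γ .prp) : Tm S N Γ .prp := .app (.app (.const .imp) a) b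
def allT (b : Tm S N Γ (.arr .i .prp)) : Tm S N Γ .prp := .app (.const .all) b

def eqF (a b : Tm S N Γ .nt) : MForm S N Γ := .atom .eq (.cons a (.cons b .nil))
def ltF (a b : Tm S N Γ .nt) : MForm S N Γ := .atom .lt (.cons a (.cons b .nil))
def lengthF (l : Tm S N Γ .atmlst) (n : Tm S N Γ .nt) : MForm S N Γ :=
  .atom .length (.cons l (.cons n .nil))
def sumF (a b c : Tm S N Γ .nt) : MForm S N Γ := .atom .sum (.cons a (.cons b (.cons c .nil)))
def elementF (a : Tm S N Γ .atm) (l : Tm S N Γ .atmlst) : MForm S N Γ :=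
  .atom .element (.cons a (.cons l .nil))
def splitF (k l m : Tm S N Γ .atmlst) : MForm S N Γ :=
  .atom .split (.cons k (.cons l (.cons m .nil)))
def permuteF (k l : Tm S N Γ .atmlst) : MForm S N Γ := .atom .permute (.cons k (.cons l .nil))
def seqF (n : Tm S N Γ .nt) (l : Tm S N Γ .atmlst) (b : Tm S N Γ .prp) : MForm S N Γ :=
  .atom .seq (.cons n (.cons l (.cons b .nil)))
def progF (a : Tm S N Γ .atm) (b : Tm S N Γ .prp) : MForm S N Γ :=
  .atom .prog (.cons a (.cons b .nil))

/-- The first four indices. -/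
abbrev v0 {σ₀ : Ty S.Ground} : Tm S N (σ₀ :: Γ) σ₀ := .bvar .zero
abbrev v1 {σ₀ σ₁ : Ty S.Ground} : Tm S N (σ₀ :: σ₁ :: Γ) σ₁ := .bvar (.succ .zero)
abbrev v2 {σ₀ σ₁ σ₂ : Ty S.Ground} : Tm S N (σ₀ :: σ₁ :: σ₂ :: Γ) σ₂ :=
  .bvar (.succ (.succ .zero))
abbrev v3 {σ₀ σ₁ σ₂ σ₃ : Ty S.Ground} : Tm S N (σ₀ :: σ₁ :: σ₂ :: σ₃ :: Γ) σ₃ :=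
  .bvar (.succ (.succ (.succ .zero)))

/-- The clauses for the predicates on natural numbers. -/
def defNat (S : Signature.{u}) : Set (Clause S) :=
  { -- I = I ≜ ⊤
    ⟨[.nt], .eq, .cons v0 (.cons v0 .nil), .top⟩,
    -- sum z J J ≜ nat J
    ⟨[.nt], .sum, .cons zeroT (.cons v0 (.cons v0 .nil)), natF v0⟩,
    -- sum (s I) J (s K) ≜ sum I J K
    ⟨[.nt, .nt, .nt], .sum, .cons (sucT v0) (.cons v1 (.cons (sucT v2) .nil)), sumF v0 v1 v2⟩,
    -- z < s J ≜ nat J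
    ⟨[.nt], .lt, .cons zeroT (.cons (sucT v0) .nil), natF v0⟩,
    -- s I < s J ≜ I < J
    ⟨[.nt, .nt], .lt, .cons (sucT v0) (.cons (sucT v1) .nil), ltF v0 v1⟩,
    -- I ≤ I ≜ ⊤
    ⟨[.nt], .le, .cons v0 (.cons v0 .nil), .top⟩,
    -- I ≤ J ≜ I < J
    ⟨[.nt, .nt], .le, .cons v0 (.cons v1 .nil), ltF v0 v1⟩ }

/-- The clauses for the predicates on lists of atoms. -/
def defList (S : Signature.{u}) : Set (Clause S) :=
  { -- length nil z ≜ ⊤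
    ⟨[], .length, .cons nilT (.cons zeroT .nil), .top⟩,
    -- length (X :: L) (s I) ≜ length L I
    ⟨[.atm, .atmlst, .nt], .length, .cons (consT v0 v1) (.cons (sucT v2) .nil), lengthF v1 v2⟩,
    -- list L ≜ ∃ i (nat i ∧ length L i)
    ⟨[.atmlst], .list, .cons v0 .nil, .ex .nt (.and (natF v0) (lengthF v1 v0))⟩,
    -- element X (X :: L) ≜ ⊤
    ⟨[.atm, .atmlst], .element, .cons v0 (.cons (consT v0 v1) .nil), .top⟩,
    -- element X (Y :: L) ≜ element X L
    ⟨[.atm, .atm, .atmlst], .element, .cons v0 (.cons (consT v1 v2) .nil), elementF v0 v2⟩,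
    -- split nil nil nil ≜ ⊤
    ⟨[], .split, .cons nilT (.cons nilT (.cons nilT .nil)), .top⟩,
    -- split (X :: L₁) (X :: L₂) L₃ ≜ split L₁ L₂ L₃
    ⟨[.atm, .atmlst, .atmlst, .atmlst], .split,
      .cons (consT v0 v1) (.cons (consT v0 v2) (.cons v3 .nil)), splitF v1 v2 v3⟩,
    -- split (X :: L₁) L₂ (X :: L₃) ≜ split L₁ L₂ L₃
    ⟨[.atm, .atmlst, .atmlst, .atmlst], .split,
      .cons (consT v0 v1) (.cons v2 (.cons (consT v0 v3) .nil)), splitF v1 v2 v3⟩,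
    -- permute nil nil ≜ ⊤
    ⟨[], .permute, .cons nilT (.cons nilT .nil), .top⟩,
    -- permute (X :: L₁) L₂ ≜ ∃ l (split L₂ (X :: nil) l ∧ permute L₁ l)
    ⟨[.atm, .atmlst, .atmlst], .permute, .cons (consT v0 v1) (.cons v2 .nil),
      .ex .atmlst (.and (splitF v3 (consT v1 nilT) v0) (permuteF v2 v0))⟩ }

/-- The clauses for object-level sequents. -/
def defIntuit (S : Signature.{u}) : Set (Clause S) :=
  { -- seq I (A' :: L) ⟨A⟩ ≜ element A (A' :: L)
    ⟨[.nt, .atm, .atmlst, .atm], .seq, .cons v0 (.cons (consT v1 v2) (.cons (atomT v3) .nil)),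
      elementF v3 (consT v1 v2)⟩,
    -- seq I L tt ≜ ⊤
    ⟨[.nt, .atmlst], .seq, .cons v0 (.cons v1 (.cons ttT .nil)), .top⟩,
    -- seq (s I) L (B & C) ≜ seq I L B ∧ seq I L C
    ⟨[.nt, .atmlst, .prp, .prp], .seq, .cons (sucT v0) (.cons v1 (.cons (andT v2 v3) .nil)),
      .and (seqF v0 v1 v2) (seqF v0 v1 v3)⟩,
    -- seq (s I) L (A ⇒ B) ≜ seq I (A :: L) B
    ⟨[.nt, .atmlst, .atm, .prp], .seq, .cons (sucT v0) (.cons v1 (.cons (impT v2 v3) .nil)),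
      seqF v0 (consT v2 v1) v3⟩,
    -- seq (s I) L (⋀ B) ≜ ∀ x seq I L (B x)
    ⟨[.nt, .atmlst, .arr .i .prp], .seq, .cons (sucT v0) (.cons v1 (.cons (allT v2) .nil)),
      .all .i (seqF v1 v2 (.app v3 v0))⟩,
    -- seq (s I) L ⟨A⟩ ≜ ∃ b (prog A b ∧ seq I L b)
    ⟨[.nt, .atmlst, .atm], .seq, .cons (sucT v0) (.cons v1 (.cons (atomT v2) .nil)),
      .ex .prp (.and (progF v3 v0) (seqF v1 v2 v0))⟩ }

/-- `prv_L B`, that is `∃ i (nat i ∧ seq i L B)`. -/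
def prv (L : Tm S ℕ [] .atmlst) (B : Tm S ℕ [] .prp) : MForm S ℕ [] :=
  .ex .nt (.and (natF v0) (seqF v0 L.wk B.wk))

end Definitions

/-! ## The object logic -/

/-- The vocabulary of the object logic has one predicate symbol, with an argument of type `atm`:
the atomic formulas of the object logic are the terms of type `atm`. -/
def objArity (S : Signature.{u}) : PUnit.{u + 1} → List (Ty S.Ground) := fun _ => [.atm]

/-- Formulas of intuitionistic logic, with quantification at all simple types. -/
abbrev OForm (S : Signature.{u}) (N : Type) (Γ : List (Ty S.Ground)) : Type u :=
  Form S (objArity S) N Γ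

section ObjectLogic
variable {S : Signature.{u}} {N : Type}

/-- A term of type `atm` as an atomic formula. -/
def OForm.atm {Γ : List (Ty S.Ground)} (a : Tm S N Γ .atm) : OForm S N Γ :=
  .atom PUnit.unit (.cons a .nil)

/-- Intuitionistic consequence: natural deduction from a set of hypotheses, formulas being
identified up to `βη`-conversion. -/
inductive Entails : Set (OForm S ℕ []) → OForm S ℕ [] → Prop
  | hyp {H : Set (OForm S ℕ [])} {A : OForm S ℕ []} : A ∈ H → Entails H A
  | conv {H : Set (OForm S ℕ [])} {A B : OForm S ℕ []} : A.Conv B → Entails H A → Entails H B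
  | topI {H : Set (OForm S ℕ [])} : Entails H .top
  | botE {H : Set (OForm S ℕ [])} {A : OForm S ℕ []} : Entails H .bot → Entails H A
  | andI {H : Set (OForm S ℕ [])} {A B : OForm S ℕ []} :
      Entails H A → Entails H B → Entails H (.and A B)
  | andE₁ {H : Set (OForm S ℕ [])} {A B : OForm S ℕ []} : Entails H (.and A B) → Entails H A
  | andE₂ {H : Set (OForm S ℕ [])} {A B : OForm S ℕ []} : Entails H (.and A B) → Entails H B
  | orI₁ {H : Set (OForm S ℕ [])} {A B : OForm S ℕ []} : Entails H A → Entails H (.or A B)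
  | orI₂ {H : Set (OForm S ℕ [])} {A B : OForm S ℕ []} : Entails H B → Entails H (.or A B)
  | orE {H : Set (OForm S ℕ [])} {A B C : OForm S ℕ []} :
      Entails H (.or A B) → Entails (insert A H) C → Entails (insert B H) C → Entails H C
  | impI {H : Set (OForm S ℕ [])} {A B : OForm S ℕ []} :
      Entails (insert A H) B → Entails H (.imp A B)
  | impE {H : Set (OForm S ℕ [])} {A B : OForm S ℕ []} :
      Entails H (.imp A B) → Entails H A → Entails H B
  | allI {H : Set (OForm S ℕ [])} {τ : Ty S.Ground} {B : OForm S ℕ [τ]} (y : ℕ) :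
      (∀ F ∈ H, ¬ F.Occurs τ y) → ¬ B.Occurs τ y →
      Entails H (B.inst (.free τ y)) → Entails H (.all τ B)
  | allE {H : Set (OForm S ℕ [])} {τ : Ty S.Ground} {B : OForm S ℕ [τ]} (t : Tm S ℕ [] τ) :
      Entails H (.all τ B) → Entails H (B.inst t)
  | exI {H : Set (OForm S ℕ [])} {τ : Ty S.Ground} {B : OForm S ℕ [τ]} (t : Tm S ℕ [] τ) :
      Entails H (B.inst t) → Entails H (.ex τ B)
  | exE {H : Set (OForm S ℕ [])} {τ : Ty S.Ground} {B : OForm S ℕ [τ]} {C : OForm S ℕ []}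
      (y : ℕ) :
      (∀ F ∈ H, ¬ F.Occurs τ y) → ¬ B.Occurs τ y → ¬ C.Occurs τ y →
      Entails H (.ex τ B) → Entails (insert (B.inst (.free τ y)) H) C → Entails H C

/-- `Translates B φ`: the term `B` of type `prp` translates to the formula `φ` of
intuitionistic logic. Terms are taken up to `βη`-conversion. -/
inductive Translates : {Γ : List (Ty S.Ground)} → Tm S N Γ .prp → OForm S N Γ → Prop
  | atom {Γ : List (Ty S.Ground)} (a : Tm S N Γ .atm) : Translates (atomT a) (OForm.atm a)
  | tt {Γ : List (Ty S.Ground)} : Translates (ttT (Γ := Γ)) .top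
  | and {Γ : List (Ty S.Ground)} {b c : Tm S N Γ .prp} {φ ψ : OForm S N Γ} :
      Translates b φ → Translates c ψ → Translates (andT b c) (.and φ ψ)
  | imp {Γ : List (Ty S.Ground)} (a : Tm S N Γ .atm) {b : Tm S N Γ .prp} {φ : OForm S N Γ} :
      Translates b φ → Translates (impT a b) (.imp (OForm.atm a) φ)
  | all {Γ : List (Ty S.Ground)} {b : Tm S N (.i :: Γ) .prp} {φ : OForm S N (.i :: Γ)} :
      Translates b φ → Translates (allT (.lam b)) (.all .i φ)
  | conv {Γ : List (Ty S.Ground)} {b b' : Tm S N Γ .prp} {φ : OForm S N Γ} :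
      b.Conv b' → Translates b φ → Translates b' φ

/-- `TranslatesList L M`: the term `L` of type `atmlst` translates to the multiset `M` of atomic
formulas. -/
inductive TranslatesList : Tm S N [] .atmlst → Multiset (OForm S N []) → Prop
  | nil : TranslatesList nilT 0
  | cons (a : Tm S N [] .atm) {l : Tm S N [] .atmlst} {M : Multiset (OForm S N [])} :
      TranslatesList l M → TranslatesList (consT a l) (OForm.atm a ::ₘ M)
  | conv {l l' : Tm S N [] .atmlst} {M : Multiset (OForm S N [])} :
      l.Conv l' → TranslatesList l M → TranslatesList l' M

/-- One clause of an object-level theory: the terms `A` and `G` (over the clause variables, whose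
types are listed in `ctx`) and the translation of `G`. -/
structure ProgClause (S : Signature.{u}) where
  ctx : List (Ty S.Ground)
  A : Tm S Empty ctx .atm
  G : Tm S Empty ctx .prp
  transG : OForm S Empty ctx
  translates : Translates G transG

/-- The definitional clause `∀ x̄ [prog A G ≜ ⊤]`. -/
def ProgClause.toClause (c : ProgClause S) : Clause S :=
  ⟨c.ctx, .prog, .cons c.A (.cons c.G .nil), .top⟩

/-- The formula `⋀ x̄ (G ⇒ A)` of intuitionistic logic. -/
def ProgClause.toForm (c : ProgClause S) : OForm S ℕ [] :=
  (Form.close c.ctx (.imp c.transG (OForm.atm c.A))).ofClosed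

/-- The definition of `prog`. -/
def defProg (T : List (ProgClause S)) : Set (Clause S) :=
  {d | ∃ c ∈ T, d = c.toClause}

/-- The corresponding theory in intuitionistic logic. -/
def theory (T : List (ProgClause S)) : Set (OForm S ℕ []) :=
  {F | ∃ c ∈ T, F = c.toForm}

end ObjectLogic

end FOLambda

/-! Both directions are semantic; neither the meta-logic nor the object logic needs cut elimination.

From derivability to consequence: since every clause respects the levels, the definition has a
two-valued model whose elements are the open terms, in which `nat` is true exactly of the terms
convertible to numerals and every other predicate is equivalent to its unfolding (`exists_model`).
All rules of the meta-logic, cut, induction and the left rule for definitions included, are sound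
for it (`Derivable.sound`). Hence a derivation of `prv L B` gives a numeral `n` with `seq n L B`
true, and `entails_of_model_seq` unfolds this truth by induction on `n`: each clause for `seq` is a
hypothesis, an introduction rule or one use of a theory formula. The universal case works because
the model contains variables, so a true universal statement can be instantiated with a fresh one.
Reading off which clause applied, and with which arguments, requires the constructors to be disjoint
and injective modulo `βη`-conversion. This is proved by a type structure in which values remember
head constructors, with no appeal to confluence or normalization.

From consequence to derivability: natural deduction is sound in Kripke structures (`Entails.sound`).
Take as worlds the finite lists of atoms, and let an atom be forced where it has a goal-directed
proof (`Uniform`). A forced goal then has a goal-directed proof (`Translates.exists_uniform`),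
because implications in goals have atomic antecedents; it follows that every formula of the theory
is forced everywhere. So a consequence of the atoms of `L` and the theory is forced at `L`, and
therefore has a goal-directed proof of some height `n`. The rules for such proofs copy the clauses
for `seq`, which yields a derivation of `seq n L B` (`Uniform.derivable`). -/

namespace FOLambda

/-! ## Substitution -/

section Substitution
variable {S : Signature.{u}} {N N' N'' : Type}

/-- The assignment that maps index `0` to `t` and the other indices by `η`. -/
def Assign.cons {Γ Δ : List (Ty S.Ground)} {σ : Ty S.Ground} (t : Tm S N Δ σ)
    (η : Assign S N Γ Δ) : Assign S N (σ :: Γ) Δ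
  | _, .zero => t
  | _, .succ x => η _ x

theorem Assign.single_eq_cons {Γ : List (Ty S.Ground)} {σ : Ty S.Ground} (t : Tm S N Γ σ) :
    Assign.single t = Assign.cons t fun _ x => .bvar x := by
  funext τ x; cases x <;> rfl

theorem Assign.eq_none {Δ : List (Ty S.Ground)} (η : Assign S N [] Δ) : η = Assign.none := by
  funext τ x; cases x

theorem Assign.cons_head_tail {Γ Δ : List (Ty S.Ground)} {σ : Ty S.Ground}
    (η : Assign S N (σ :: Γ) Δ) :
    Assign.cons (η _ .zero) (fun τ x => η τ (.succ x)) = η := by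
  funext τ x; cases x <;> rfl

theorem Var.lift_comp {T : Type u} {Γ Δ Θ : List T} (ρ : ∀ τ : T, Var Γ τ → Var Δ τ)
    (ρ' : ∀ τ : T, Var Δ τ → Var Θ τ) (σ : T) :
    (fun τ x => Var.lift ρ' σ τ (Var.lift ρ σ τ x)) = Var.lift (fun τ x => ρ' τ (ρ τ x)) σ := by
  funext τ x; cases x <;> rfl

theorem Tm.rename_rename {Γ Δ Θ : List (Ty S.Ground)} {τ : Ty S.Ground} (t : Tm S N Γ τ)
    (ρ : ∀ τ : Ty S.Ground, Var Γ τ → Var Δ τ) (ρ' : ∀ τ : Ty S.Ground, Var Δ τ → Var Θ τ) :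
    (t.rename ρ).rename ρ' = t.rename fun τ x => ρ' τ (ρ τ x) := by
  induction t generalizing Δ Θ with
  | bvar | free | const => rfl
  | app t t' ih ih' => simp only [Tm.rename, ih, ih']
  | lam t ih => simp only [Tm.rename, ih, Var.lift_comp]

theorem Tm.rename_wk {Γ Δ : List (Ty S.Ground)} {σ τ : Ty S.Ground} (t : Tm S N Γ τ)
    (ρ : ∀ τ : Ty S.Ground, Var Γ τ → Var Δ τ) :
    t.wk.rename (Var.lift ρ σ) = (t.rename ρ).wk := by
  simp only [Tm.wk, Tm.rename_rename]; rfl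

theorem Tm.bind_rename {Γ Δ Θ : List (Ty S.Ground)} {τ : Ty S.Ground} (t : Tm S N Γ τ)
    (ρ : ∀ τ : Ty S.Ground, Var Γ τ → Var Δ τ) (θ : NameSubst S N N' Θ) (η : Assign S N' Δ Θ) :
    (t.rename ρ).bind θ η = t.bind θ fun τ x => η τ (ρ τ x) := by
  induction t generalizing Δ Θ with
  | bvar | free | const => rfl
  | app t t' ih ih' => simp only [Tm.rename, Tm.bind, ih, ih']
  | lam t ih =>
    simp only [Tm.rename, Tm.bind, ih]
    congr 2
    funext τ x; cases x <;> rfl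

theorem Tm.bind_wk {Γ Θ : List (Ty S.Ground)} {σ τ : Ty S.Ground} (t : Tm S N Γ τ)
    (θ : NameSubst S N N' Θ) (r : Tm S N' Θ σ) (η : Assign S N' Γ Θ) :
    t.wk.bind θ (Assign.cons r η) = t.bind θ η :=
  Tm.bind_rename t _ θ _

theorem Tm.rename_bind {Γ Δ Θ : List (Ty S.Ground)} {τ : Ty S.Ground} (t : Tm S N Γ τ)
    (θ : NameSubst S N N' Δ) (η : Assign S N' Γ Δ) (ρ : ∀ τ : Ty S.Ground, Var Δ τ → Var Θ τ) :
    (t.bind θ η).rename ρ =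
      t.bind (fun τ n => (θ τ n).rename ρ) fun τ x => (η τ x).rename ρ := by
  induction t generalizing Δ Θ with
  | bvar | free | const => rfl
  | app t t' ih ih' => simp only [Tm.rename, Tm.bind, ih, ih']
  | lam t ih =>
    simp only [Tm.rename, Tm.bind, ih]
    congr 2
    · funext τ n; exact Tm.rename_wk _ _
    · funext τ x; cases x
      · rfl
      · exact Tm.rename_wk _ _

theorem Tm.wk_bind_lift {Γ Δ : List (Ty S.Ground)} {σ τ : Ty S.Ground} (t : Tm S N Γ τ)
    (θ : NameSubst S N N' Δ) (η : Assign S N' Γ Δ) :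
    t.wk.bind (θ.wk σ) (η.lift σ) = (t.bind θ η).wk := by
  rw [Tm.wk, Tm.bind_rename, Tm.wk, Tm.rename_bind]; rfl

theorem Tm.bind_bind {Γ Δ Θ : List (Ty S.Ground)} {τ : Ty S.Ground} (t : Tm S N Γ τ)
    (θ : NameSubst S N N' Δ) (η : Assign S N' Γ Δ)
    (θ' : NameSubst S N' N'' Θ) (η' : Assign S N'' Δ Θ) :
    (t.bind θ η).bind θ' η' =
      t.bind (fun τ n => (θ τ n).bind θ' η') fun τ x => (η τ x).bind θ' η' := by
  induction t generalizing Δ Θ with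
  | bvar | free | const => rfl
  | app t t' ih ih' => simp only [Tm.bind, ih, ih']
  | lam t ih =>
    simp only [Tm.bind, ih]
    congr 2
    · funext τ n; exact Tm.wk_bind_lift _ _ _
    · funext τ x; cases x
      · rfl
      · exact Tm.wk_bind_lift _ _ _

theorem Assign.lift_bvar {Γ : List (Ty S.Ground)} (σ : Ty S.Ground) :
    Assign.lift (fun _ x => .bvar x : Assign S N Γ Γ) σ = fun _ x => .bvar x := by
  funext τ x; cases x <;> rfl

theorem Tm.bind_id {Γ : List (Ty S.Ground)} {τ : Ty S.Ground} (t : Tm S N Γ τ) :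
    t.bind (fun τ n => .free τ n) (fun _ x => .bvar x) = t := by
  induction t with
  | bvar | free | const => rfl
  | app t t' ih ih' => simp only [Tm.bind, ih, ih']
  | lam t ih =>
    simp only [Tm.bind, Assign.lift_bvar]
    exact congrArg Tm.lam ih

theorem Tm.bind_id_none {τ : Ty S.Ground} (t : Tm S N [] τ) :
    t.bind (fun τ n => .free τ n) Assign.none = t := by
  rw [← Assign.eq_none (fun _ x => .bvar x)]; exact t.bind_id

theorem Tm.wk_inst {Γ : List (Ty S.Ground)} {σ τ : Ty S.Ground} (t : Tm S N Γ τ)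
    (r : Tm S N Γ σ) : t.wk.inst r = t := by
  rw [Tm.inst, Assign.single_eq_cons, Tm.bind_wk, Tm.bind_id]

/-- Instantiation followed by a substitution. -/
theorem Tm.inst_bind {Γ Δ : List (Ty S.Ground)} {σ τ : Ty S.Ground} (t : Tm S N (σ :: Γ) τ)
    (r : Tm S N Γ σ) (θ : NameSubst S N N' Δ) (η : Assign S N' Γ Δ) :
    (t.inst r).bind θ η = t.bind θ (Assign.cons (r.bind θ η) η) := by
  rw [Tm.inst, Tm.bind_bind]
  congr 1
  funext τ x; cases x <;> rfl

/-- A substitution below a binder followed by an extension of the assignment. -/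
theorem Tm.bind_lift_bind {Γ Δ Θ : List (Ty S.Ground)} {σ τ : Ty S.Ground}
    (t : Tm S N (σ :: Γ) τ) (θ : NameSubst S N N' Δ) (η : Assign S N' Γ Δ)
    (θ' : NameSubst S N' N'' Θ) (η' : Assign S N'' Δ Θ) (r : Tm S N'' Θ σ) :
    (t.bind (θ.wk σ) (η.lift σ)).bind θ' (Assign.cons r η') =
      t.bind (fun τ n => (θ τ n).bind θ' η')
        (Assign.cons r fun τ x => (η τ x).bind θ' η') := by
  rw [Tm.bind_bind]
  congr 1
  · funext τ n; exact Tm.bind_wk _ _ _ _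
  · funext τ x; cases x
    · rfl
    · exact Tm.bind_wk _ _ _ _

theorem Tm.bind_lift_inst {Γ Δ : List (Ty S.Ground)} {σ τ : Ty S.Ground}
    (t : Tm S N (σ :: Γ) τ) (θ : NameSubst S N N' Δ) (η : Assign S N' Γ Δ) (r : Tm S N' Δ σ) :
    (t.bind (θ.wk σ) (η.lift σ)).inst r = t.bind θ (Assign.cons r η) := by
  rw [Tm.inst, Assign.single_eq_cons, Tm.bind_lift_bind]
  simp only [Tm.bind_id]

/-! ### Convertibility and substitution -/

theorem Tm.Conv.bind {Γ : List (Ty S.Ground)} {τ : Ty S.Ground} {t t' : Tm S N Γ τ}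
    (h : t.Conv t') : ∀ {Δ : List (Ty S.Ground)} (θ : NameSubst S N N' Δ) (η : Assign S N' Γ Δ),
    (t.bind θ η).Conv (t'.bind θ η) := by
  induction h with
  | refl t => exact fun _ _ => .refl _
  | symm _ ih => exact fun θ η => (ih θ η).symm
  | trans _ _ ih ih' => exact fun θ η => (ih θ η).trans (ih' θ η)
  | app _ _ ih ih' => exact fun θ η => .app (ih θ η) (ih' θ η)
  | lam _ ih => exact fun θ η => .lam (ih _ _)
  | beta t r =>
    intro Δ θ η
    rw [Tm.inst_bind, ← Tm.bind_lift_inst]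
    exact .beta _ _
  | eta t =>
    intro Δ θ η
    simp only [Tm.bind, Tm.wk_bind_lift]
    exact .eta _

theorem Tm.wk_eq_bind {Γ : List (Ty S.Ground)} {σ τ : Ty S.Ground} (t : Tm S N Γ τ) :
    (t.wk (σ := σ)) = t.bind (fun τ n => .free τ n) (fun _ x => .bvar (.succ x)) := by
  conv_lhs => rw [← t.bind_id]
  rw [Tm.wk, Tm.rename_bind]; rfl

theorem Tm.Conv.wk {Γ : List (Ty S.Ground)} {σ τ : Ty S.Ground} {t t' : Tm S N Γ τ}
    (h : t.Conv t') : (t.wk (σ := σ)).Conv t'.wk := by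
  rw [Tm.wk_eq_bind, Tm.wk_eq_bind]
  exact h.bind _ _

theorem Tm.conv_bind_bind {Γ : List (Ty S.Ground)} {τ : Ty S.Ground} (t : Tm S N Γ τ) :
    ∀ {Δ : List (Ty S.Ground)} {θ θ' : NameSubst S N N' Δ} {η η' : Assign S N' Γ Δ},
    (∀ τ n, (θ τ n).Conv (θ' τ n)) → (∀ τ x, (η τ x).Conv (η' τ x)) →
    (t.bind θ η).Conv (t.bind θ' η') := by
  induction t with
  | bvar x => exact fun _ hη => hη _ x
  | free τ n => exact fun hθ _ => hθ τ n
  | const => exact fun _ _ => .refl _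
  | app t t' ih ih' => exact fun hθ hη => .app (ih hθ hη) (ih' hθ hη)
  | lam t ih =>
    intro Δ θ θ' η η' hθ hη
    refine .lam (ih (fun τ n => (hθ τ n).wk) fun τ x => ?_)
    cases x
    · exact .refl _
    · exact (hη _ _).wk

theorem Tms.bind_bind {Γ Δ Θ τs : List (Ty S.Ground)} (ts : Tms S N Γ τs)
    (θ : NameSubst S N N' Δ) (η : Assign S N' Γ Δ)
    (θ' : NameSubst S N' N'' Θ) (η' : Assign S N'' Δ Θ) :
    (ts.bind θ η).bind θ' η' =
      ts.bind (fun τ n => (θ τ n).bind θ' η') fun τ x => (η τ x).bind θ' η' := by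
  induction ts with
  | nil => rfl
  | cons t ts ih => simp only [Tms.bind, Tm.bind_bind, ih]

theorem Tms.Conv.refl {Γ τs : List (Ty S.Ground)} (ts : Tms S N Γ τs) : ts.Conv ts := by
  induction ts with
  | nil => exact .nil
  | cons t ts ih => exact .cons (.refl t) ih

theorem Tms.Conv.symm {Γ τs : List (Ty S.Ground)} {ts ts' : Tms S N Γ τs} (h : ts.Conv ts') :
    ts'.Conv ts := by
  induction h with
  | nil => exact .nil
  | cons h _ ih => exact .cons h.symm ih

theorem Tms.Conv.trans {Γ τs : List (Ty S.Ground)} {ts ts' ts'' : Tms S N Γ τs}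
    (h : ts.Conv ts') (h' : ts'.Conv ts'') : ts.Conv ts'' := by
  induction h with
  | nil => exact h'
  | cons h _ ih => cases h' with | cons h₁ h₂ => exact .cons (h.trans h₁) (ih h₂)

theorem Tms.Conv.bind {Γ τs : List (Ty S.Ground)} {ts ts' : Tms S N Γ τs}
    (h : ts.Conv ts') {Δ : List (Ty S.Ground)} (θ : NameSubst S N N' Δ) (η : Assign S N' Γ Δ) :
    (ts.bind θ η).Conv (ts'.bind θ η) := by
  induction h with
  | nil => exact .nil
  | cons h _ ih => exact .cons (h.bind θ η) ih

theorem Tms.conv_bind_bind {Γ τs : List (Ty S.Ground)} (ts : Tms S N Γ τs)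
    {Δ : List (Ty S.Ground)} {θ θ' : NameSubst S N N' Δ} {η η' : Assign S N' Γ Δ}
    (hθ : ∀ τ n, (θ τ n).Conv (θ' τ n)) (hη : ∀ τ x, (η τ x).Conv (η' τ x)) :
    (ts.bind θ η).Conv (ts.bind θ' η') := by
  induction ts with
  | nil => exact .nil
  | cons t ts ih => exact .cons (t.conv_bind_bind hθ hη) ih

/-! ### Named variables -/

open scoped Classical in
/-- `θ` changed to `r` at the variable `n` of type `σ`. -/
noncomputable def NameSubst.update {Δ : List (Ty S.Ground)} (θ : NameSubst S N N' Δ)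
    (σ : Ty S.Ground) (n : N) (r : Tm S N' Δ σ) : NameSubst S N N' Δ :=
  fun τ m => if h : σ = τ ∧ m = n then h.1 ▸ r else θ τ m

theorem NameSubst.update_same {Δ : List (Ty S.Ground)} (θ : NameSubst S N N' Δ)
    (σ : Ty S.Ground) (n : N) (r : Tm S N' Δ σ) : θ.update σ n r σ n = r := by
  simp [NameSubst.update]

theorem NameSubst.update_of_ne {Δ : List (Ty S.Ground)} (θ : NameSubst S N N' Δ)
    {σ τ : Ty S.Ground} {m n : N} (r : Tm S N' Δ σ) (h : ¬ (τ = σ ∧ m = n)) :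
    θ.update σ n r τ m = θ τ m :=
  dif_neg fun h' => h ⟨h'.1.symm, h'.2⟩

theorem Tm.bind_congr {Γ : List (Ty S.Ground)} {τ : Ty S.Ground} (t : Tm S N Γ τ) :
    ∀ {Δ : List (Ty S.Ground)} {θ θ' : NameSubst S N N' Δ} {η : Assign S N' Γ Δ},
    (∀ τ n, t.Occurs τ n → θ τ n = θ' τ n) → t.bind θ η = t.bind θ' η := by
  induction t with
  | bvar | const => exact fun _ => rfl
  | free τ n => exact fun h => h τ n ⟨rfl, rfl⟩
  | app t t' ih ih' =>
    intro Δ θ θ' η h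
    simp only [Tm.bind]
    rw [ih fun τ n ho => h τ n (.inl ho), ih' fun τ n ho => h τ n (.inr ho)]
  | lam t ih =>
    intro Δ θ θ' η h
    simp only [Tm.bind]
    exact congrArg Tm.lam (ih fun τ n ho => congrArg Tm.wk (h τ n ho))

theorem Tms.bind_congr {Γ τs Δ : List (Ty S.Ground)} (ts : Tms S N Γ τs)
    {θ θ' : NameSubst S N N' Δ} {η : Assign S N' Γ Δ}
    (h : ∀ τ n, ts.Occurs τ n → θ τ n = θ' τ n) : ts.bind θ η = ts.bind θ' η := by
  induction ts with
  | nil => rfl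
  | cons t ts ih =>
    simp only [Tms.bind]
    rw [t.bind_congr fun τ n ho => h τ n (.inl ho), ih fun τ n ho => h τ n (.inr ho)]

theorem Tm.bind_update_of_not_occurs {Γ Δ : List (Ty S.Ground)} {τ : Ty S.Ground}
    (t : Tm S N Γ τ) {σ : Ty S.Ground} {n : N} (h : ¬ t.Occurs σ n) (θ : NameSubst S N N' Δ)
    (r : Tm S N' Δ σ) (η : Assign S N' Γ Δ) : t.bind (θ.update σ n r) η = t.bind θ η :=
  t.bind_congr fun _ _ ho => θ.update_of_ne r fun e => h (by rwa [e.1, e.2] at ho)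

/-- Only finitely many named variables occur in a term. -/
theorem Tm.exists_bound {Γ : List (Ty S.Ground)} {τ : Ty S.Ground} (t : Tm S ℕ Γ τ) :
    ∃ k, ∀ σ n, t.Occurs σ n → n < k := by
  induction t with
  | bvar | const => exact ⟨0, fun _ _ h => h.elim⟩
  | free τ n => exact ⟨n + 1, fun _ _ h => h.2 ▸ Nat.lt_succ_self _⟩
  | app t t' ih ih' =>
    obtain ⟨k, hk⟩ := ih
    obtain ⟨k', hk'⟩ := ih'
    exact ⟨max k k', fun σ n h => h.elim (fun h => lt_max_of_lt_left (hk σ n h))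
      fun h => lt_max_of_lt_right (hk' σ n h)⟩
  | lam t ih => exact ih

theorem Tms.exists_bound {Γ τs : List (Ty S.Ground)} (ts : Tms S ℕ Γ τs) :
    ∃ k, ∀ σ n, ts.Occurs σ n → n < k := by
  induction ts with
  | nil => exact ⟨0, fun _ _ h => h.elim⟩
  | cons t ts ih =>
    obtain ⟨k, hk⟩ := t.exists_bound
    obtain ⟨k', hk'⟩ := ih
    exact ⟨max k k', fun σ n h => h.elim (fun h => lt_max_of_lt_left (hk σ n h))
      fun h => lt_max_of_lt_right (hk' σ n h)⟩

/-- Extensionality of the open term model. -/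
theorem Tm.Conv.ext {σ τ : Ty S.Ground} {t t' : Tm S ℕ [] (.arr σ τ)}
    (h : ∀ r, (Tm.app t r).Conv (.app t' r)) : t.Conv t' := by
  obtain ⟨k, hk⟩ := t.exists_bound
  obtain ⟨k', hk'⟩ := t'.exists_bound
  -- The chosen variable is fresh for both terms. Replacing it by index `0` turns convertibility at
  -- this single argument into convertibility below a binder; abstraction and `η` then give the
  -- claim.
  let θ : NameSubst S ℕ ℕ [σ] :=
    NameSubst.update (fun τ n => .free τ n) σ (max k k') (.bvar .zero)
  have wk : ∀ r : Tm S ℕ [] (.arr σ τ), ¬ r.Occurs σ (max k k') → r.bind θ Assign.none = r.wk := by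
    intro r hr
    rw [Tm.bind_update_of_not_occurs r hr, Tm.wk_eq_bind, Assign.eq_none fun _ x => .bvar (.succ x)]
  have key := (h (.free σ (max k k'))).bind θ Assign.none
  simp only [Tm.bind] at key
  rw [wk t fun ho => absurd (hk _ _ ho) (by simp), wk t' fun ho => absurd (hk' _ _ ho) (by simp),
    show θ σ (max k k') = _ from NameSubst.update_same _ _ _ _] at key
  exact ((Tm.Conv.eta t).symm.trans key.lam).trans (.eta t')

end Substitution

/-! ## Constructors are injective modulo conversion

The full set-theoretic type structure whose ground domains consist of the conversion classes of
terms, each paired with a record of the head constructor, is related to the term model by a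
partial surjection. Convertible terms have the same value, and the value of a constructor term
determines the classes of its arguments. -/

section Injectivity
variable {S : Signature.{u}} {N N' : Type}

def convSetoid (S : Signature.{u}) (τ : Ty S.Ground) : Setoid (Tm S ℕ [] τ) :=
  ⟨Tm.Conv, .refl, .symm, .trans⟩

/-- Conversion classes. -/
def Cls (S : Signature.{u}) (τ : Ty S.Ground) : Type u := Quotient (convSetoid S τ)

def Tm.cls {τ : Ty S.Ground} (t : Tm S ℕ [] τ) : Cls S τ := Quotient.mk (convSetoid S τ) t

theorem Tm.cls_eq {τ : Ty S.Ground} {t t' : Tm S ℕ [] τ} : t.cls = t'.cls ↔ t.Conv t' :=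
  ⟨fun h => @Quotient.exact _ (convSetoid S τ) _ _ h,
    fun h => @Quotient.sound _ (convSetoid S τ) _ _ h⟩

/-- The head constructor of a term and the classes of its arguments. -/
inductive HeadShape (S : Signature.{u}) : Type u
  | neutral
  | zero
  | suc (n : Cls S .nt)
  | nil
  | cons (a : Cls S .atm) (l : Cls S .atmlst)
  | atom (a : Cls S .atm)
  | tt
  | and (b c : Cls S .prp)
  | imp (a : Cls S .atm) (b : Cls S .prp)
  | all (b : Cls S (.arr .i .prp))

/-- The domains of the type structure. -/
def Dom (S : Signature.{u}) : Ty S.Ground → Type u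
  | .base b => Cls S (.base b) × HeadShape S
  | .arr σ τ => Dom S σ → Dom S τ

/-- `Represents τ a t`: the element `a` represents the term `t`. -/
def Represents : (τ : Ty S.Ground) → Dom S τ → Tm S ℕ [] τ → Prop
  | .base _, a, t => a.1 = t.cls
  | .arr σ τ, f, t => ∀ a s, Represents σ a s → Represents τ (f a) (.app t s)

theorem Represents.conv {τ : Ty S.Ground} {a : Dom S τ} {t t' : Tm S ℕ [] τ}
    (h : Represents τ a t) (ht : t.Conv t') : Represents τ a t' := by
  induction τ with
  | base b => exact Eq.trans h (Tm.cls_eq.2 ht)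
  | arr σ τ _ ih => exact fun b s hs => ih (h b s hs) (ht.app (.refl s))

/-- The two halves are proved together because each arrow case needs both at smaller types. A
representing function chooses a term for its argument, and functionality at `σ` makes the choice
irrelevant; conversely, totality at `σ` supplies the arguments on which extensionality compares two
terms. -/
theorem represents_total_and_functional (τ : Ty S.Ground) :
    (∀ t, ∃ a, Represents τ a t) ∧
      ∀ a t t', Represents τ a t → Represents τ a t' → t.Conv t' := by
  classical
  induction τ with
  | base b =>
    exact ⟨fun t => ⟨(t.cls, .neutral), rfl⟩, fun a t t' h h' =>
      Tm.cls_eq.1 (Eq.trans (Eq.symm h) h')⟩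
  | arr σ τ ihσ ihτ =>
    refine ⟨fun t => ?_, fun f t t' h h' => Tm.Conv.ext fun r => ?_⟩
    -- Elements that represent no term are never tested, so their image is arbitrary.
    · refine ⟨fun a => if h : ∃ s, Represents σ a s then (ihτ.1 (.app t h.choose)).choose
        else (ihτ.1 (.free τ 0)).choose, fun a s hs => ?_⟩
      have h : ∃ s, Represents σ a s := ⟨s, hs⟩
      beta_reduce
      rw [dif_pos h]
      exact (ihτ.1 (.app t h.choose)).choose_spec.conv
        ((Tm.Conv.refl t).app (ihσ.2 _ _ _ h.choose_spec hs))
    · obtain ⟨a, ha⟩ := ihσ.1 r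
      exact ihτ.2 _ _ _ (h a r ha) (h' a r ha)

/-- Some element that represents a given term. -/
noncomputable def reflect {τ : Ty S.Ground} (t : Tm S ℕ [] τ) : Dom S τ :=
  ((represents_total_and_functional τ).1 t).choose

theorem represents_reflect {τ : Ty S.Ground} (t : Tm S ℕ [] τ) : Represents τ (reflect t) t :=
  ((represents_total_and_functional τ).1 t).choose_spec

open scoped Classical in
/-- A term represented by a given element, if there is one. -/
noncomputable def reify {τ : Ty S.Ground} (a : Dom S τ) : Tm S ℕ [] τ :=
  if h : ∃ t, Represents τ a t then h.choose else .free τ 0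

theorem Represents.reify {τ : Ty S.Ground} {a : Dom S τ} {t : Tm S ℕ [] τ}
    (h : Represents τ a t) : (reify a).Conv t := by
  have h' : ∃ t, Represents τ a t := ⟨t, h⟩
  rw [FOLambda.reify, dif_pos h']
  exact (represents_total_and_functional τ).2 _ _ _ h'.choose_spec h

/-- The first component is the class of the actual application, as `Represents` demands; the second
records the constructor with the classes of its arguments. For the further constants any
representing element will do, since only shapes of constructor terms are compared. -/
noncomputable def Const.eval : {τ : Ty S.Ground} → Const S τ → Dom S τ
  | _, .zero => ((zeroT : Tm S ℕ [] .nt).cls, .zero)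
  | _, .suc => fun n => ((sucT (reify n)).cls, .suc (reify n).cls)
  | _, .nil => ((nilT : Tm S ℕ [] .atmlst).cls, .nil)
  | _, .cons => fun a l => ((consT (reify a) (reify l)).cls, .cons (reify a).cls (reify l).cls)
  | _, .atom => fun a => ((atomT (reify a)).cls, .atom (reify a).cls)
  | _, .tt => ((ttT : Tm S ℕ [] .prp).cls, .tt)
  | _, .and => fun b c => ((andT (reify b) (reify c)).cls, .and (reify b).cls (reify c).cls)
  | _, .imp => fun a b => ((impT (reify a) (reify b)).cls, .imp (reify a).cls (reify b).cls)
  | _, .all => fun b => ((allT (reify b)).cls, .all (reify b).cls)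
  | _, .other c => reflect (.const (.other c))

theorem Const.represents_eval {τ : Ty S.Ground} (c : Const S τ) :
    Represents τ c.eval (.const c) := by
  cases c with
  | zero | nil | tt => exact rfl
  | suc | atom | all =>
    exact fun a s h => Tm.cls_eq.2 (.app (.refl _) h.reify)
  | cons | and | imp =>
    exact fun a s h a' s' h' => Tm.cls_eq.2 (.app (.app (.refl _) h.reify) h'.reify)
  | other c => exact represents_reflect _

def extendVal {Γ : List (Ty S.Ground)} {σ : Ty S.Ground} (a : Dom S σ)
    (ρ : ∀ τ, Var Γ τ → Dom S τ) : ∀ τ, Var (σ :: Γ) τ → Dom S τ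
  | _, .zero => a
  | _, .succ x => ρ _ x

noncomputable def Tm.eval (ν : ∀ τ : Ty S.Ground, N → Dom S τ) {Γ : List (Ty S.Ground)}
    {τ : Ty S.Ground} : Tm S N Γ τ → (∀ τ, Var Γ τ → Dom S τ) → Dom S τ
  | .bvar x, ρ => ρ _ x
  | .free τ n, _ => ν τ n
  | .const c, _ => c.eval
  | .app t t', ρ => (t.eval ν ρ) (t'.eval ν ρ)
  | .lam t, ρ => fun a => t.eval ν (extendVal a ρ)

theorem Tm.eval_rename (ν : ∀ τ : Ty S.Ground, N → Dom S τ) {Γ Δ : List (Ty S.Ground)}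
    {τ : Ty S.Ground} (t : Tm S N Γ τ) (r : ∀ τ, Var Γ τ → Var Δ τ)
    (ρ : ∀ τ, Var Δ τ → Dom S τ) :
    (t.rename r).eval ν ρ = t.eval ν fun τ x => ρ τ (r τ x) := by
  induction t generalizing Δ with
  | bvar | free | const => rfl
  | app t t' ih ih' => simp only [Tm.rename, Tm.eval, ih, ih']
  | lam t ih =>
    simp only [Tm.rename, Tm.eval, ih]
    funext a
    congr 1
    funext τ x; cases x <;> rfl

theorem Tm.eval_bind (ν : ∀ τ : Ty S.Ground, N' → Dom S τ) {Γ Δ : List (Ty S.Ground)}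
    {τ : Ty S.Ground} (t : Tm S N Γ τ) (θ : NameSubst S N N' Δ) (η : Assign S N' Γ Δ)
    (ρ : ∀ τ, Var Δ τ → Dom S τ) :
    (t.bind θ η).eval ν ρ =
      t.eval (fun τ n => (θ τ n).eval ν ρ) fun τ x => (η τ x).eval ν ρ := by
  induction t generalizing Δ with
  | bvar | free | const => rfl
  | app t t' ih ih' => simp only [Tm.bind, Tm.eval, ih, ih']
  | lam t ih =>
    simp only [Tm.bind, Tm.eval, ih]
    funext a
    congr 1
    · funext τ n; exact Tm.eval_rename _ _ _ _
    · funext τ x; cases x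
      · rfl
      · exact Tm.eval_rename _ _ _ _

theorem Tm.Conv.eval_eq {Γ : List (Ty S.Ground)} {τ : Ty S.Ground} {t t' : Tm S N Γ τ}
    (h : t.Conv t') (ν : ∀ τ : Ty S.Ground, N → Dom S τ) :
    ∀ ρ, t.eval ν ρ = t'.eval ν ρ := by
  induction h with
  | refl t => exact fun _ => rfl
  | symm _ ih => exact fun ρ => (ih ρ).symm
  | trans _ _ ih ih' => exact fun ρ => (ih ρ).trans (ih' ρ)
  | app _ _ ih ih' => exact fun ρ => by simp only [Tm.eval, ih, ih']
  | lam _ ih => exact fun ρ => funext fun a => ih _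
  | beta t r =>
    intro ρ
    rw [Tm.inst, Tm.eval_bind]
    simp only [Tm.eval]
    congr 1
    funext τ x; cases x <;> rfl
  | eta t =>
    intro ρ
    simp only [Tm.eval, Tm.wk, Tm.eval_rename]
    rfl

/-- The fundamental lemma of the logical relation `Represents`. Under a `λ` the two sides differ by
a `β`-step, which the relation absorbs. -/
theorem Tm.represents_eval {Γ : List (Ty S.Ground)} {τ : Ty S.Ground} (t : Tm S N Γ τ)
    {ν : ∀ τ : Ty S.Ground, N → Dom S τ} {θ : NameSubst S N ℕ []}
    (hν : ∀ τ n, Represents τ (ν τ n) (θ τ n)) :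
    ∀ {ρ : ∀ τ, Var Γ τ → Dom S τ} {η : Assign S ℕ Γ []},
    (∀ τ x, Represents τ (ρ τ x) (η τ x)) → Represents τ (t.eval ν ρ) (t.bind θ η) := by
  induction t with
  | bvar x => exact fun h => h _ x
  | free τ n => exact fun _ => hν τ n
  | const c => exact fun _ => c.represents_eval
  | app t t' ih ih' => exact fun h => ih h _ _ (ih' h)
  | lam t ih =>
    intro ρ η h a s hs
    refine (ih (ρ := extendVal a ρ) (η := Assign.cons s η) fun τ x => ?_).conv ?_
    · cases x
      · exact hs
      · exact h _ _
    · rw [← Tm.bind_lift_inst]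
      exact (Tm.Conv.beta _ _).symm

/-- The value of a term under the valuation that reflects the named variables. -/
noncomputable def Tm.value {τ : Ty S.Ground} (t : Tm S ℕ [] τ) : Dom S τ :=
  t.eval (fun τ n => reflect (.free τ n)) fun _ x => nomatch x

theorem Tm.Conv.value_eq {τ : Ty S.Ground} {t t' : Tm S ℕ [] τ} (h : t.Conv t') :
    t.value = t'.value :=
  h.eval_eq _ _

/-- The value of a term determines its class at every type, function types included. This is why the
recorded arguments of a constructor can be recovered. -/
theorem Tm.cls_reify_value {τ : Ty S.Ground} (t : Tm S ℕ [] τ) : (reify t.value).cls = t.cls := by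
  refine Tm.cls_eq.2 (Represents.reify ?_)
  have h := t.represents_eval (θ := fun τ n => .free τ n) (η := Assign.none)
    (fun τ n => represents_reflect (.free τ n)) (ρ := fun _ x => nomatch x) fun τ x => nomatch x
  rwa [t.bind_id_none] at h

/-- The head constructor of a term of ground type. -/
noncomputable def Tm.shape {b : Base S.Ground} (t : Tm S ℕ [] (.base b)) : HeadShape S :=
  Prod.snd (α := Cls S (.base b)) t.value

/-- Together with the computations of shapes that follow, this makes the constructors disjoint and
injective modulo conversion. -/
theorem Tm.Conv.shape_eq {b : Base S.Ground} {t t' : Tm S ℕ [] (.base b)} (h : t.Conv t') :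
    t.shape = t'.shape :=
  congrArg (Prod.snd (α := Cls S (.base b))) h.value_eq

theorem shape_sucT (n : Tm S ℕ [] .nt) : (sucT n).shape = .suc n.cls :=
  congrArg HeadShape.suc n.cls_reify_value

theorem shape_nilT : (nilT : Tm S ℕ [] .atmlst).shape = .nil := rfl

theorem shape_consT (a : Tm S ℕ [] .atm) (l : Tm S ℕ [] .atmlst) :
    (consT a l).shape = .cons a.cls l.cls :=
  congrArg₂ HeadShape.cons a.cls_reify_value l.cls_reify_value

theorem shape_atomT (a : Tm S ℕ [] .atm) : (atomT a).shape = .atom a.cls :=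
  congrArg HeadShape.atom a.cls_reify_value

theorem shape_ttT : (ttT : Tm S ℕ [] .prp).shape = .tt := rfl

theorem shape_andT (b c : Tm S ℕ [] .prp) : (andT b c).shape = .and b.cls c.cls :=
  congrArg₂ HeadShape.and b.cls_reify_value c.cls_reify_value

theorem shape_impT (a : Tm S ℕ [] .atm) (b : Tm S ℕ [] .prp) :
    (impT a b).shape = .imp a.cls b.cls :=
  congrArg₂ HeadShape.imp a.cls_reify_value b.cls_reify_value

theorem shape_allT (b : Tm S ℕ [] (.arr .i .prp)) : (allT b).shape = .all b.cls :=
  congrArg HeadShape.all b.cls_reify_value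

end Injectivity

/-! ## Formulas under substitution -/

section FormulaSubstitution
variable {S : Signature.{u}} {P : Type u} {ar : P → List (Ty S.Ground)} {N N' N'' : Type}

theorem Form.Conv.refl {Γ : List (Ty S.Ground)} (B : Form S ar N Γ) : B.Conv B := by
  induction B with
  | atom p ts => exact .atom p (.refl ts)
  | top => exact .top
  | bot => exact .bot
  | and _ _ ih ih' => exact .and ih ih'
  | or _ _ ih ih' => exact .or ih ih'
  | imp _ _ ih ih' => exact .imp ih ih'
  | all τ _ ih => exact .all τ ih
  | ex τ _ ih => exact .ex τ ih

theorem Form.Conv.bind {Γ : List (Ty S.Ground)} {B C : Form S ar N Γ} (h : B.Conv C) :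
    ∀ {Δ : List (Ty S.Ground)} (θ : NameSubst S N N' Δ) (η : Assign S N' Γ Δ),
    (B.bind θ η).Conv (C.bind θ η) := by
  induction h with
  | atom p h => exact fun θ η => .atom p (h.bind θ η)
  | top => exact fun _ _ => .top
  | bot => exact fun _ _ => .bot
  | and _ _ ih ih' => exact fun θ η => .and (ih θ η) (ih' θ η)
  | or _ _ ih ih' => exact fun θ η => .or (ih θ η) (ih' θ η)
  | imp _ _ ih ih' => exact fun θ η => .imp (ih θ η) (ih' θ η)
  | all τ _ ih => exact fun θ η => .all τ (ih _ _)
  | ex τ _ ih => exact fun θ η => .ex τ (ih _ _)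

theorem Form.bind_bind {Γ Δ Θ : List (Ty S.Ground)} (B : Form S ar N Γ)
    (θ : NameSubst S N N' Δ) (η : Assign S N' Γ Δ)
    (θ' : NameSubst S N' N'' Θ) (η' : Assign S N'' Δ Θ) :
    (B.bind θ η).bind θ' η' =
      B.bind (fun τ n => (θ τ n).bind θ' η') fun τ x => (η τ x).bind θ' η' := by
  have hθ : ∀ {Δ Θ : List (Ty S.Ground)} (σ : Ty S.Ground) (θ : NameSubst S N N' Δ)
      (θ' : NameSubst S N' N'' Θ) (η' : Assign S N'' Δ Θ),
      (fun τ n => (θ.wk σ τ n).bind (θ'.wk σ) (η'.lift σ)) =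
        NameSubst.wk (fun τ n => (θ τ n).bind θ' η') σ :=
    fun σ θ θ' η' => by funext τ n; exact Tm.wk_bind_lift _ _ _
  have hη : ∀ {Γ Δ Θ : List (Ty S.Ground)} (σ : Ty S.Ground) (η : Assign S N' Γ Δ)
      (θ' : NameSubst S N' N'' Θ) (η' : Assign S N'' Δ Θ),
      (fun τ x => (η.lift σ τ x).bind (θ'.wk σ) (η'.lift σ)) =
        Assign.lift (fun τ x => (η τ x).bind θ' η') σ := by
    intro Γ Δ Θ σ η θ' η'
    funext τ x; cases x
    · rfl
    · exact Tm.wk_bind_lift _ _ _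
  induction B generalizing Δ Θ with
  | atom p ts => simp only [Form.bind, Tms.bind_bind]
  | top | bot => rfl
  | and _ _ ih ih' | or _ _ ih ih' | imp _ _ ih ih' => simp only [Form.bind, ih, ih']
  | all τ _ ih | ex τ _ ih => simp only [Form.bind, ih, hθ, hη]

theorem Form.bind_lift_inst {Γ Δ : List (Ty S.Ground)} {σ : Ty S.Ground}
    (B : Form S ar N (σ :: Γ)) (θ : NameSubst S N N' Δ) (η : Assign S N' Γ Δ) (r : Tm S N' Δ σ) :
    (B.bind (θ.wk σ) (η.lift σ)).inst r = B.bind θ (Assign.cons r η) := by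
  rw [Form.inst, Form.bind_bind, Assign.single_eq_cons]
  congr 1
  · funext τ n
    exact (Tm.bind_wk _ _ _ _).trans (Tm.bind_id _)
  · funext τ x; cases x
    · rfl
    · exact (Tm.bind_wk _ _ _ _).trans (Tm.bind_id _)

theorem Form.exists_bound {Γ : List (Ty S.Ground)} (B : Form S ar ℕ Γ) :
    ∃ k, ∀ σ n, B.Occurs σ n → n < k := by
  induction B with
  | atom p ts => exact ts.exists_bound
  | top | bot => exact ⟨0, fun _ _ h => h.elim⟩
  | and _ _ ih ih' | or _ _ ih ih' | imp _ _ ih ih' =>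
    obtain ⟨k, hk⟩ := ih
    obtain ⟨k', hk'⟩ := ih'
    exact ⟨max k k', fun σ n h => h.elim (fun h => lt_max_of_lt_left (hk σ n h))
      fun h => lt_max_of_lt_right (hk' σ n h)⟩
  | all τ _ ih | ex τ _ ih => exact ih

theorem exists_bound_occurs (M : Multiset (Form S ar ℕ [])) :
    ∃ k, ∀ F ∈ M, ∀ σ n, F.Occurs σ n → n < k := by
  induction M using Multiset.induction with
  | empty => exact ⟨0, fun F h => absurd h (Multiset.notMem_zero F)⟩
  | cons B M ih =>
    obtain ⟨k, hk⟩ := B.exists_bound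
    obtain ⟨k', hk'⟩ := ih
    refine ⟨max k k', fun F hF σ n h => ?_⟩
    rcases Multiset.mem_cons.1 hF with rfl | hF
    · exact lt_max_of_lt_left (hk σ n h)
    · exact lt_max_of_lt_right (hk' F hF σ n h)

end FormulaSubstitution

/-! ## Kripke forcing over the domain of open terms -/

section Forcing
variable {S : Signature.{u}} {P : Type u} {ar : P → List (Ty S.Ground)} {N N' : Type}

/-- Interpretations of the predicate symbols over the open terms. -/
abbrev Interp (S : Signature.{u}) {P : Type u} (ar : P → List (Ty S.Ground)) : Type u :=
  ∀ p : P, Tms S ℕ [] (ar p) → Prop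

/-- Forcing in a Kripke structure with worlds `W`, whose constant domain at type `τ` consists of
the terms of type `τ`. -/
def Form.Forces {W : Type u} [Preorder W] (I : W → Interp S ar) {Γ : List (Ty S.Ground)} :
    Form S ar N Γ → NameSubst S N ℕ [] → Assign S ℕ Γ [] → W → Prop
  | .atom p ts, θ, η, w => I w p (ts.bind θ η)
  | .top, _, _, _ => True
  | .bot, _, _, _ => False
  | .and B C, θ, η, w => B.Forces I θ η w ∧ C.Forces I θ η w
  | .or B C, θ, η, w => B.Forces I θ η w ∨ C.Forces I θ η w
  | .imp B C, θ, η, w => ∀ w', w ≤ w' → B.Forces I θ η w' → C.Forces I θ η w'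
  -- Later worlds need not be mentioned: the domain is constant and forcing persists.
  | .all _ B, θ, η, w => ∀ t, B.Forces I θ (Assign.cons t η) w
  | .ex _ B, θ, η, w => ∃ t, B.Forces I θ (Assign.cons t η) w

variable {W : Type u} [Preorder W] {I : W → Interp S ar}

theorem Form.Forces.mono (hI : ∀ w w', w ≤ w' → ∀ p ts, I w p ts → I w' p ts)
    {Γ : List (Ty S.Ground)} {B : Form S ar N Γ} {θ : NameSubst S N ℕ []} :
    ∀ {η : Assign S ℕ Γ []} {w w' : W}, w ≤ w' → B.Forces I θ η w → B.Forces I θ η w' := by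
  induction B with
  | atom p ts => exact fun hw => hI _ _ hw _ _
  | top | bot => exact fun _ h => h
  | and _ _ ih ih' => exact fun hw h => ⟨ih hw h.1, ih' hw h.2⟩
  | or _ _ ih ih' => exact fun hw h => h.imp (ih hw) (ih' hw)
  | imp _ _ ih ih' => exact fun hw h w'' hw' => h w'' (hw.trans hw')
  | all τ _ ih => exact fun hw h t => ih hw (h t)
  | ex τ _ ih => exact fun hw ⟨t, h⟩ => ⟨t, ih hw h⟩

theorem Form.forces_bind {Γ Δ : List (Ty S.Ground)} (B : Form S ar N Γ)
    (θ : NameSubst S N N' Δ) (η : Assign S N' Γ Δ) (θ' : NameSubst S N' ℕ []) :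
    ∀ (η' : Assign S ℕ Δ []) (w : W), (B.bind θ η).Forces I θ' η' w ↔
      B.Forces I (fun τ n => (θ τ n).bind θ' η') (fun τ x => (η τ x).bind θ' η') w := by
  have hθ : ∀ {Δ : List (Ty S.Ground)} (σ : Ty S.Ground) (θ : NameSubst S N N' Δ)
      (η' : Assign S ℕ Δ []) (t : Tm S ℕ [] σ),
      (fun τ n => (θ.wk σ τ n).bind θ' (Assign.cons t η')) = fun τ n => (θ τ n).bind θ' η' :=
    fun σ θ η' t => by funext τ n; exact Tm.bind_wk _ _ _ _
  have hη : ∀ {Γ Δ : List (Ty S.Ground)} (σ : Ty S.Ground) (η : Assign S N' Γ Δ)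
      (η' : Assign S ℕ Δ []) (t : Tm S ℕ [] σ),
      (fun τ x => (η.lift σ τ x).bind θ' (Assign.cons t η')) =
        Assign.cons t fun τ x => (η τ x).bind θ' η' := by
    intro Γ Δ σ η η' t
    funext τ x; cases x
    · rfl
    · exact Tm.bind_wk _ _ _ _
  induction B generalizing Δ with
  | atom p ts => exact fun η' w => by simp only [Form.bind, Form.Forces, Tms.bind_bind]
  | top | bot => exact fun _ _ => Iff.rfl
  | and _ _ ih ih' | or _ _ ih ih' | imp _ _ ih ih' =>
    exact fun η' w => by simp only [Form.bind, Form.Forces, ih, ih']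
  | all τ _ ih | ex τ _ ih =>
    exact fun η' w => by simp only [Form.bind, Form.Forces, ih, hθ, hη]

theorem Form.forces_inst {Γ : List (Ty S.Ground)} {σ : Ty S.Ground} (B : Form S ar ℕ (σ :: Γ))
    (t : Tm S ℕ Γ σ) (θ : NameSubst S ℕ ℕ []) (η : Assign S ℕ Γ []) (w : W) :
    (B.inst t).Forces I θ η w ↔ B.Forces I θ (Assign.cons (t.bind θ η) η) w := by
  rw [Form.inst, Form.forces_bind]
  refine iff_of_eq ?_
  congr 1
  funext τ x; cases x <;> rfl

theorem Form.forces_congr {Γ : List (Ty S.Ground)} {B : Form S ar N Γ}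
    {θ θ' : NameSubst S N ℕ []} (h : ∀ τ n, B.Occurs τ n → θ τ n = θ' τ n) :
    ∀ {η : Assign S ℕ Γ []} {w : W}, B.Forces I θ η w ↔ B.Forces I θ' η w := by
  induction B with
  | atom p ts => exact fun {η w} => by simp only [Form.Forces, ts.bind_congr h]
  | top | bot => exact Iff.rfl
  | and _ _ ih ih' | or _ _ ih ih' | imp _ _ ih ih' =>
    exact fun {η w} => by
      simp only [Form.Forces, ih fun τ n ho => h τ n (.inl ho), ih' fun τ n ho => h τ n (.inr ho)]
  | all τ _ ih | ex τ _ ih => exact fun {η w} => by simp only [Form.Forces, ih h]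

theorem Form.forces_update {Γ : List (Ty S.Ground)} {B : Form S ar N Γ} {σ : Ty S.Ground} {n : N}
    (h : ¬ B.Occurs σ n) (θ : NameSubst S N ℕ []) (r : Tm S ℕ [] σ) {η : Assign S ℕ Γ []} {w : W} :
    B.Forces I (θ.update σ n r) η w ↔ B.Forces I θ η w :=
  Form.forces_congr fun _ _ ho => θ.update_of_ne r fun e => h (by rwa [e.1, e.2] at ho)

/-- Instantiation by a variable that does not occur. -/
theorem Form.forces_inst_update {σ : Ty S.Ground} {B : Form S ar ℕ [σ]} {n : ℕ}
    (h : ¬ B.Occurs σ n) (θ : NameSubst S ℕ ℕ []) (t : Tm S ℕ [] σ) {w : W} :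
    (B.inst (.free σ n)).Forces I (θ.update σ n t) Assign.none w ↔
      B.Forces I θ (Assign.cons t Assign.none) w := by
  rw [Form.forces_inst, Form.forces_update h]
  simp only [Tm.bind, NameSubst.update_same]

theorem Form.Conv.forces_iff
    (hc : ∀ w p ts ts', Tms.Conv ts ts' → I w p ts → I w p ts')
    {Γ : List (Ty S.Ground)} {B C : Form S ar N Γ} (h : B.Conv C)
    {θ : NameSubst S N ℕ []} :
    ∀ {η : Assign S ℕ Γ []} {w : W}, B.Forces I θ η w ↔ C.Forces I θ η w := by
  induction h with
  | atom p h => exact ⟨hc _ _ _ _ (h.bind _ _), hc _ _ _ _ (h.symm.bind _ _)⟩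
  | top | bot => exact Iff.rfl
  | and _ _ ih ih' | or _ _ ih ih' | imp _ _ ih ih' =>
    simp only [Form.Forces, ih, ih', implies_true]
  | all τ _ ih | ex τ _ ih => simp only [Form.Forces, ih, implies_true]

theorem Form.forces_conv_assign
    (hc : ∀ w p ts ts', Tms.Conv ts ts' → I w p ts → I w p ts')
    {Γ : List (Ty S.Ground)} (B : Form S ar N Γ)
    {θ θ' : NameSubst S N ℕ []} (hθ : ∀ τ n, (θ τ n).Conv (θ' τ n)) :
    ∀ {η η' : Assign S ℕ Γ []}, (∀ τ x, (η τ x).Conv (η' τ x)) →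
    ∀ {w : W}, B.Forces I θ η w ↔ B.Forces I θ' η' w := by
  have hcons : ∀ {Γ : List (Ty S.Ground)} {σ : Ty S.Ground} {η η' : Assign S ℕ Γ []}
      (t : Tm S ℕ [] σ), (∀ τ x, (η τ x).Conv (η' τ x)) →
      ∀ τ x, (Assign.cons t η τ x).Conv (Assign.cons t η' τ x) := by
    intro Γ σ η η' t h τ x
    cases x
    · exact .refl _
    · exact h _ _
  induction B with
  | atom p ts =>
    exact fun hη => ⟨hc _ _ _ _ (ts.conv_bind_bind hθ hη),
      hc _ _ _ _ (ts.conv_bind_bind hθ hη).symm⟩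
  | top | bot => exact fun _ => Iff.rfl
  | and _ _ ih ih' => exact fun hη => and_congr (ih hη) (ih' hη)
  | or _ _ ih ih' => exact fun hη => or_congr (ih hη) (ih' hη)
  | imp _ _ ih ih' =>
    exact fun hη => forall₂_congr fun _ _ => imp_congr (ih hη) (ih' hη)
  | all τ _ ih => exact fun hη => forall_congr' fun t => ih (hcons t hη)
  | ex τ _ ih => exact fun hη => exists_congr fun t => ih (hcons t hη)

end Forcing

/-! ### Inversion of convertibility for formulas, and numerals. -/

theorem Form.Conv.trans {S : Signature.{u}} {P : Type u} {ar : P → List (Ty S.Ground)} {N : Type}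
    {Γ : List (Ty S.Ground)} {B C E : Form S ar N Γ} (h : B.Conv C) (h' : C.Conv E) :
    B.Conv E := by
  induction h with
  | atom p h => cases h' with | atom _ h' => exact .atom p (h.trans h')
  | top | bot => exact h'
  | and _ _ ih ih' => cases h' with | and h h' => exact .and (ih h) (ih' h')
  | or _ _ ih ih' => cases h' with | or h h' => exact .or (ih h) (ih' h')
  | imp _ _ ih ih' => cases h' with | imp h h' => exact .imp (ih h) (ih' h')
  | all τ _ ih => cases h' with | all _ h => exact .all τ (ih h)
  | ex τ _ ih => cases h' with | ex _ h => exact .ex τ (ih h)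

theorem Form.Conv.pred_eq {S : Signature.{u}} {P : Type u} {ar : P → List (Ty S.Ground)} {N : Type}
    {Γ : List (Ty S.Ground)} {p q : P} {ts : Tms S N Γ (ar p)} {us : Tms S N Γ (ar q)}
    (h : (Form.atom p ts : Form S ar N Γ).Conv (.atom q us)) : p = q := by
  cases h; rfl

theorem Form.Conv.args {S : Signature.{u}} {P : Type u} {ar : P → List (Ty S.Ground)} {N : Type}
    {Γ : List (Ty S.Ground)} {p : P} {ts us : Tms S N Γ (ar p)}
    (h : (Form.atom p ts : Form S ar N Γ).Conv (.atom p us)) : ts.Conv us := by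
  cases h; assumption

/-- Numerals. -/
def num {S : Signature.{u}} {N : Type} {Γ : List (Ty S.Ground)} : ℕ → Tm S N Γ .nt
  | 0 => zeroT
  | n + 1 => sucT (num n)

/-! ## Stratified definitions have a two-valued model -/

section Stratification
variable {S : Signature.{u}}

/-- The substitution on the empty set of names. -/
def NameSubst.empty {N' : Type} {Δ : List (Ty S.Ground)} : NameSubst S Empty N' Δ :=
  fun _ n => n.elim

theorem NameSubst.eq_empty {N' : Type} {Δ : List (Ty S.Ground)} (θ : NameSubst S Empty N' Δ) :
    θ = NameSubst.empty := by
  funext τ n; exact n.elim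

/-- Truth in a two-valued structure, that is, forcing with a single world. -/
abbrev Form.Holds {P : Type u} {ar : P → List (Ty S.Ground)} {N : Type} {Γ : List (Ty S.Ground)}
    (I : Interp S ar) (B : Form S ar N Γ) (θ : NameSubst S N ℕ []) (η : Assign S ℕ Γ []) : Prop :=
  B.Forces (W := PUnit.{u + 1}) (fun _ => I) θ η PUnit.unit

/-- An implication counts its antecedent one level higher. In a formula of level at most `n`,
predicates of level `n` therefore occur only positively, and those in antecedents lie below `n`,
where the two interpretations agree. -/
theorem Form.Holds.mono_level {P : Type u} {ar : P → List (Ty S.Ground)} {N : Type}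
    {lvl : P → ℕ} {θ : NameSubst S N ℕ []} {Γ : List (Ty S.Ground)} (B : Form S ar N Γ) :
    ∀ {n : ℕ} {I J : Interp S ar} {η : Assign S ℕ Γ []},
    (∀ p, lvl p < n → ∀ ts, I p ts ↔ J p ts) → (∀ p, lvl p ≤ n → ∀ ts, I p ts → J p ts) →
    B.level lvl ≤ n → B.Holds I θ η → B.Holds J θ η := by
  induction B with
  | atom p ts => exact fun _ h hB => h p hB _
  | top | bot => exact fun _ _ _ h => h
  | and B C ih ih' =>
    exact fun he hl hB h => ⟨ih he hl (le_trans (le_max_left _ _) hB) h.1,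
      ih' he hl (le_trans (le_max_right _ _) hB) h.2⟩
  | or B C ih ih' =>
    exact fun he hl hB h => h.imp (ih he hl (le_trans (le_max_left _ _) hB))
      (ih' he hl (le_trans (le_max_right _ _) hB))
  | imp B C ih ih' =>
    intro n I J η he hl hB h w hw hJ
    have hB' : B.level lvl < n := le_trans (le_max_left _ _) hB
    refine ih' he hl (le_trans (le_max_right _ _) hB) (h w hw ?_)
    exact ih (fun p hp ts => (he p (hp.trans hB') ts).symm)
      (fun p hp ts => (he p (hp.trans_lt hB') ts).2) le_rfl hJ
  | all τ B ih => exact fun he hl hB h t => ih he hl hB (h t)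
  | ex τ B ih => exact fun he hl hB ⟨t, h⟩ => ⟨t, ih he hl hB h⟩

/-- One unfolding of the definition `D` and of the generation of the natural numbers. -/
def definitionStep (D : Set (Clause S)) (I : Interp S (Pred.arity (S := S))) :
    Interp S (Pred.arity (S := S)) :=
  -- Convertibility with a formula `nat n` already forces `p` to be `nat`, which avoids transporting
  -- the arguments along an equation of predicates.
  fun p us => (∃ n, (Form.atom p us : MForm S ℕ []).Conv (natF (num n))) ∨
    (p ≠ .nat ∧ ∃ c ∈ D, ∃ η : Assign S ℕ c.ctx [],
      (Form.atom p us : MForm S ℕ []).Conv (Clause.formInst c.head η) ∧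
        c.body.Holds I NameSubst.empty η)

theorem definitionStep_mono_level {D : Set (Clause S)} {lvl : Pred S → ℕ}
    (hlvl : ∀ c ∈ D, c.body.level lvl ≤ lvl c.pred) {I J : Interp S (Pred.arity (S := S))}
    {p : Pred S} (he : ∀ q, lvl q < lvl p → ∀ ts, I q ts ↔ J q ts)
    (hl : ∀ q, lvl q ≤ lvl p → ∀ ts, I q ts → J q ts) (us : Tms S ℕ [] p.arity)
    (h : definitionStep D I p us) : definitionStep D J p us := by
  refine h.imp_right ?_
  rintro ⟨hp, c, hc, η, hη, hB⟩
  exact ⟨hp, c, hc, η, hη, Form.Holds.mono_level _ he hl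
    ((hlvl c hc).trans_eq (congrArg lvl (Form.Conv.pred_eq hη).symm)) hB⟩

/-- `Y` on the levels below `n`, and `X` on the others. -/
def Interp.override {P : Type u} {ar : P → List (Ty S.Ground)} (lvl : P → ℕ) (n : ℕ)
    (Y X : Interp S ar) : Interp S ar :=
  fun p us => if lvl p < n then Y p us else X p us

/-- The operator for the predicates of level `n`, given an interpretation of the levels below. -/
def levelStep {D : Set (Clause S)} {lvl : Pred S → ℕ}
    (hlvl : ∀ c ∈ D, c.body.level lvl ≤ lvl c.pred) (n : ℕ) (Y : Interp S (Pred.arity (S := S))) :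
    Interp S (Pred.arity (S := S)) →o Interp S (Pred.arity (S := S)) where
  toFun X p us := lvl p = n ∧ definitionStep D (Interp.override lvl n Y X) p us
  monotone' X X' hX p us := by
    rintro ⟨rfl, h⟩
    refine ⟨rfl, definitionStep_mono_level hlvl (fun q hq ts => ?_) (fun q _ ts => ?_) us h⟩
    · simp only [Interp.override, if_pos hq]
    · simp only [Interp.override]
      split
      · exact id
      · exact hX q ts

/-- The interpretation of the predicates of level below `n`. -/
noncomputable def levelModel {D : Set (Clause S)} {lvl : Pred S → ℕ}
    (hlvl : ∀ c ∈ D, c.body.level lvl ≤ lvl c.pred) : ℕ → Interp S (Pred.arity (S := S))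
  | 0 => fun _ _ => False
  | n + 1 => Interp.override lvl n (levelModel hlvl n) (levelStep hlvl n (levelModel hlvl n)).lfp

/-- Negative occurrences prevent one monotone operator for all predicates. With the lower levels
fixed, the operator for a single level is monotone, so the levels are filled in turn by least fixed
points. Only the fixed-point equation is used later, not leastness. -/
theorem exists_model {D : Set (Clause S)} {lvl : Pred S → ℕ}
    (hlvl : ∀ c ∈ D, c.body.level lvl ≤ lvl c.pred) :
    ∃ I : Interp S (Pred.arity (S := S)), ∀ p us, I p us ↔ definitionStep D I p us := by
  -- A predicate is settled once its own level has been added, and later stages leave it unchanged.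
  let I : Interp S (Pred.arity (S := S)) := fun p => levelModel hlvl (lvl p + 1) p
  have stable : ∀ n p us, lvl p < n → (levelModel hlvl n p us ↔ I p us) := by
    intro n
    induction n with
    | zero => exact fun p us h => absurd h (Nat.not_lt_zero _)
    | succ n ih =>
      intro p us h
      rcases Nat.lt_succ_iff_lt_or_eq.1 h with h | rfl
      · rw [← ih p us h, levelModel, Interp.override, if_pos h]
      · rfl
  refine ⟨I, fun p us => ?_⟩
  -- At its own level the predicate is the least fixed point, so unfolding it refers to the stage
  -- that contains this very level. That stage agrees with `I` on all levels that the bodies can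
  -- mention.
  have h : I p us ↔ definitionStep D (levelModel hlvl (lvl p + 1)) p us := by
    change Interp.override lvl (lvl p) _ _ p us ↔ _
    rw [Interp.override, if_neg (lt_irrefl _), ← OrderHom.map_lfp]
    exact and_iff_right rfl
  rw [h]
  refine ⟨definitionStep_mono_level hlvl (fun q hq ts => stable _ q ts (Nat.lt_succ_of_lt hq))
    (fun q hq ts => (stable _ q ts (Nat.lt_succ_of_le hq)).1) us,
    definitionStep_mono_level hlvl (fun q hq ts => (stable _ q ts (Nat.lt_succ_of_lt hq)).symm)
    (fun q hq ts => (stable _ q ts (Nat.lt_succ_of_le hq)).2) us⟩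

end Stratification

/-! ## Soundness of the meta-logic -/

section Soundness
variable {S : Signature.{u}} {D : Set (Clause S)} {I : Interp S (Pred.arity (S := S))}

theorem Clause.formInst_bind {Γ : List (Ty S.Ground)} (B : MForm S Empty Γ) (η : Assign S ℕ Γ [])
    (θ : NameSubst S ℕ ℕ []) :
    (Clause.formInst B η).bind θ Assign.none =
      Clause.formInst B fun τ x => (η τ x).bind θ Assign.none := by
  rw [Clause.formInst, Form.bind_bind, Clause.formInst]
  congr 1
  funext τ n; exact n.elim

theorem Clause.holds_formInst {Γ : List (Ty S.Ground)} (B : MForm S Empty Γ)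
    (η : Assign S ℕ Γ []) (θ : NameSubst S ℕ ℕ []) :
    (Clause.formInst B η).Holds I θ Assign.none ↔
      B.Holds I NameSubst.empty fun τ x => (η τ x).bind θ Assign.none := by
  rw [Form.Holds, Clause.formInst, Form.forces_bind, NameSubst.eq_empty fun τ n => _]

theorem model_conv (hI : ∀ p us, I p us ↔ definitionStep D I p us) (p : Pred S)
    (us us' : Tms S ℕ [] p.arity) (h : us.Conv us') (hp : I p us) : I p us' := by
  rw [hI] at hp ⊢
  rcases hp with ⟨n, hn⟩ | ⟨hp, c, hc, η, hη, hB⟩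
  · exact .inl ⟨n, (Form.Conv.atom p h.symm).trans hn⟩
  · exact .inr ⟨hp, c, hc, η, (Form.Conv.atom p h.symm).trans hη, hB⟩

theorem model_nat_iff (hI : ∀ p us, I p us ↔ definitionStep D I p us) (t : Tm S ℕ [] .nt) :
    I .nat (.cons t .nil) ↔ ∃ n, t.Conv (num n) := by
  refine (hI _ _).trans ⟨?_, ?_⟩
  · rintro (⟨n, hn⟩ | ⟨hp, -⟩)
    · exact ⟨n, by cases hn.args with | cons h _ => exact h⟩
    · exact absurd rfl hp
  · rintro ⟨n, hn⟩
    exact .inl ⟨n, .atom _ (.cons hn .nil)⟩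

theorem model_defined_iff (hI : ∀ p us, I p us ↔ definitionStep D I p us) {p : Pred S}
    (hp : p ≠ .nat) (us : Tms S ℕ [] p.arity) :
    I p us ↔ ∃ c ∈ D, ∃ η : Assign S ℕ c.ctx [],
      (Form.atom p us : MForm S ℕ []).Conv (Clause.formInst c.head η) ∧
        c.body.Holds I NameSubst.empty η := by
  rw [hI]
  constructor
  · rintro (⟨n, hn⟩ | h)
    · exact absurd hn.pred_eq hp
    · exact h.2
  · exact fun h => .inr ⟨hp, h⟩

/-- The claim covers all substitutions for the named variables at once, as needed for
eigenvariables, for the induction step at an arbitrary number, and for the unifiers in `defL`. -/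
theorem Derivable.sound (hI : ∀ p us, I p us ↔ definitionStep D I p us)
    {Γ : Multiset (MForm S ℕ [])} {B : MForm S ℕ []} (h : Derivable D Γ B) :
    ∀ θ : NameSubst S ℕ ℕ [], (∀ F ∈ Γ, F.Holds I θ Assign.none) → B.Holds I θ Assign.none := by
  have hc : ∀ (_ : PUnit.{u + 1}) p ts ts', Tms.Conv ts ts' → I p ts → I p ts' :=
    fun _ => model_conv hI
  induction h with
  | conv hΓ hB _ ih =>
    intro θ h
    refine (hB.forces_iff hc).1 (ih θ fun F hF => ?_)
    obtain ⟨F', hF', hFF'⟩ := Multiset.exists_mem_of_rel_of_mem hΓ hF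
    exact (hFF'.forces_iff hc).2 (h F' hF')
  | botL => exact fun θ h => (h _ (Multiset.mem_cons_self _ _)).elim
  | topR => exact fun _ _ => trivial
  | andL₁ _ ih =>
    intro θ h
    rw [Multiset.forall_mem_cons] at h
    exact ih θ (Multiset.forall_mem_cons.2 ⟨h.1.1, h.2⟩)
  | andL₂ _ ih =>
    intro θ h
    rw [Multiset.forall_mem_cons] at h
    exact ih θ (Multiset.forall_mem_cons.2 ⟨h.1.2, h.2⟩)
  | andR _ _ ih ih' => exact fun θ h => ⟨ih θ h, ih' θ h⟩
  | orL _ _ ih ih' =>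
    intro θ h
    rw [Multiset.forall_mem_cons] at h
    exact h.1.elim (fun hB => ih θ (Multiset.forall_mem_cons.2 ⟨hB, h.2⟩))
      fun hC => ih' θ (Multiset.forall_mem_cons.2 ⟨hC, h.2⟩)
  | orR₁ _ ih => exact fun θ h => .inl (ih θ h)
  | orR₂ _ ih => exact fun θ h => .inr (ih θ h)
  | impL _ _ ih ih' =>
    intro θ h
    rw [Multiset.forall_mem_cons] at h
    exact ih' θ (Multiset.forall_mem_cons.2 ⟨h.1 _ le_rfl (ih θ h.2), h.2⟩)
  | impR _ ih => exact fun θ h w _ hB => ih θ (Multiset.forall_mem_cons.2 ⟨hB, h⟩)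
  | allL t _ ih =>
    intro θ h
    rw [Multiset.forall_mem_cons] at h
    exact ih θ (Multiset.forall_mem_cons.2 ⟨(Form.forces_inst _ t θ _ _).2 (h.1 _), h.2⟩)
  | allR y hΓ hB _ ih =>
    intro θ h t
    exact (Form.forces_inst_update hB θ t).1
      (ih _ fun F hF => (Form.forces_update (hΓ F hF) θ t).2 (h F hF))
  | exL y hΓ hB hC _ ih =>
    intro θ h
    rw [Multiset.forall_mem_cons] at h
    obtain ⟨⟨t, ht⟩, h⟩ := h
    refine (Form.forces_update hC θ t).1 (ih _ (Multiset.forall_mem_cons.2 ⟨?_, fun F hF => ?_⟩))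
    · exact (Form.forces_inst_update hB θ t).2 ht
    · exact (Form.forces_update (hΓ F hF) θ t).2 (h F hF)
  | exR t _ ih => exact fun θ h => ⟨_, (Form.forces_inst _ t θ _ _).1 (ih θ h)⟩
  | init p ts => exact fun θ h => h _ (Multiset.mem_cons_self _ _)
  | contrL _ ih =>
    intro θ h
    have h' := h
    rw [Multiset.forall_mem_cons] at h'
    exact ih θ (Multiset.forall_mem_cons.2 ⟨h'.1, h⟩)
  | cut _ _ ih ih' =>
    intro θ h
    exact ih' θ (Multiset.forall_mem_cons.2 ⟨ih θ fun F hF => h F (Multiset.mem_add.2 (.inl hF)),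
      fun F hF => h F (Multiset.mem_add.2 (.inr hF))⟩)
  | natR_zero => exact fun θ _ => (model_nat_iff hI _).2 ⟨0, .refl _⟩
  | natR_suc _ ih =>
    intro θ h
    obtain ⟨n, hn⟩ := (model_nat_iff hI _).1 (ih θ h)
    exact (model_nat_iff hI _).2 ⟨n + 1, .app (.refl _) hn⟩
  | @natL Γ t C B j hj _ _ _ ih₀ ih₁ ih =>
    intro θ h
    rw [Multiset.forall_mem_cons] at h
    obtain ⟨n, hn⟩ := (model_nat_iff hI _).1 h.1
    -- Only numerals satisfy `nat`, so ordinary induction suffices; the step premise is used with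
    -- its variable `j` sent to `num k`.
    have key : ∀ k, B.Holds I θ (Assign.cons (num k) Assign.none) := by
      intro k
      induction k with
      | zero =>
        exact (Form.forces_inst _ _ θ _ _).1 (ih₀ θ fun F hF => absurd hF (Multiset.notMem_zero F))
      | succ k ihk =>
        have := ih₁ (θ.update .nt j (num k)) fun F hF => by
          rw [Multiset.mem_singleton.1 hF]
          exact (Form.forces_inst_update hj θ _).2 ihk
        rw [Form.Holds, Form.forces_inst, Form.forces_update hj] at this
        simp only [Tm.bind, sucT, NameSubst.update_same] at this
        exact this
    refine ih θ (Multiset.forall_mem_cons.2 ⟨(Form.forces_inst _ _ θ _ _).2 ?_, h.2⟩)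
    refine (B.forces_conv_assign hc (fun _ _ => .refl _) fun τ x => ?_).1 (key n)
    cases x with
    | zero => exact hn.symm
    | succ x => cases x
  | defR p us c η hp hcD hη _ ih =>
    intro θ h
    refine (model_defined_iff hI hp _).2 ⟨c, hcD, _, ?_, (Clause.holds_formInst _ _ _).1 (ih θ h)⟩
    rw [← Clause.formInst_bind]
    exact hη.bind θ Assign.none
  | @defL Γ C p us U hp hU _ ih =>
    intro θ h
    rw [Multiset.forall_mem_cons] at h
    obtain ⟨c, hcD, η, hη, hB⟩ := (model_defined_iff hI hp _).1 h.1
    -- The clause instance that makes the atom true is a unifier, hence factors through a member `π`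
    -- of the complete set. The premise for `π` is then evaluated under the remaining substitution
    -- `σ`.
    obtain ⟨π, hπ, σ, hnames, hvars⟩ := (hU c hcD).2 ⟨θ, η⟩ hη
    have hsubst : ∀ F : MForm S ℕ [],
        (F.subst π.names).Holds I σ Assign.none ↔ F.Holds I θ Assign.none := by
      intro F
      rw [Form.Holds, MForm.subst, Form.forces_bind]
      exact F.forces_conv_assign hc (fun τ n => (hnames τ n).symm) fun τ x => nomatch x
    refine (hsubst C).1 (ih c hcD π hπ σ (Multiset.forall_mem_cons.2 ⟨?_, fun F hF => ?_⟩))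
    · exact (Clause.holds_formInst _ _ _).2
        ((c.body.forces_conv_assign hc (fun _ _ => .refl _) hvars).1 hB)
    · obtain ⟨G, hG, rfl⟩ := Multiset.mem_map.1 hF
      exact (hsubst G).2 (h.2 G hG)

end Soundness

/-! ## Translations -/

section Translations
variable {S : Signature.{u}} {N N' : Type}

theorem Translates.bind {Γ : List (Ty S.Ground)} {b : Tm S N Γ .prp} {φ : OForm S N Γ}
    (h : Translates b φ) : ∀ {Δ : List (Ty S.Ground)} (θ : NameSubst S N N' Δ)
    (η : Assign S N' Γ Δ), Translates (b.bind θ η) (φ.bind θ η) := by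
  induction h with
  | atom a => exact fun θ η => .atom _
  | tt => exact fun _ _ => .tt
  | and _ _ ih ih' => exact fun θ η => .and (ih θ η) (ih' θ η)
  | imp a _ ih => exact fun θ η => .imp _ (ih θ η)
  | all _ ih => exact fun θ η => .all (ih _ _)
  | conv h _ ih => exact fun θ η => .conv (h.bind θ η) (ih θ η)

/-- Successive uses of `conv` merge into one conversion between `B` and a term with a visible head
constructor. -/
theorem Translates.inv {Γ : List (Ty S.Ground)} {B : Tm S N Γ .prp} {φ : OForm S N Γ}
    (h : Translates B φ) :
    (∃ a, (atomT a).Conv B ∧ φ = OForm.atm a) ∨ (ttT.Conv B ∧ φ = .top) ∨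
    (∃ b c φ₁ φ₂, (andT b c).Conv B ∧ φ = .and φ₁ φ₂ ∧ Translates b φ₁ ∧ Translates c φ₂) ∨
    (∃ a b φ₁, (impT a b).Conv B ∧ φ = .imp (OForm.atm a) φ₁ ∧ Translates b φ₁) ∨
    (∃ b φ₁, (allT (.lam b)).Conv B ∧ φ = .all .i φ₁ ∧ Translates b φ₁) := by
  induction h with
  | atom a => exact .inl ⟨a, .refl _, rfl⟩
  | tt => exact .inr (.inl ⟨.refl _, rfl⟩)
  | and h h' => exact .inr (.inr (.inl ⟨_, _, _, _, .refl _, rfl, h, h'⟩))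
  | imp a h => exact .inr (.inr (.inr (.inl ⟨_, _, _, .refl _, rfl, h⟩)))
  | all h => exact .inr (.inr (.inr (.inr ⟨_, _, .refl _, rfl, h⟩)))
  | conv hb _ ih =>
    rcases ih with ⟨a, h, h'⟩ | ⟨h, h'⟩ | ⟨b, c, φ₁, φ₂, h, h'⟩ | ⟨a, b, φ₁, h, h'⟩ | ⟨b, φ₁, h, h'⟩
    · exact .inl ⟨a, h.trans hb, h'⟩
    · exact .inr (.inl ⟨h.trans hb, h'⟩)
    · exact .inr (.inr (.inl ⟨b, c, φ₁, φ₂, h.trans hb, h'⟩))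
    · exact .inr (.inr (.inr (.inl ⟨a, b, φ₁, h.trans hb, h'⟩)))
    · exact .inr (.inr (.inr (.inr ⟨b, φ₁, h.trans hb, h'⟩)))

/-- As in the four inversions after it, comparing shapes refutes the wrong constructors and
identifies the arguments of the right one modulo conversion. -/
theorem Translates.inv_atomT {a : Tm S ℕ [] .atm} {φ : OForm S ℕ []}
    (h : Translates (atomT a) φ) : ∃ a', a'.Conv a ∧ φ = OForm.atm a' := by
  rcases h.inv with ⟨a', h, h'⟩ | ⟨h, -⟩ | ⟨b, c, φ₁, φ₂, h, -⟩ | ⟨a, b, φ₁, h, -⟩ | ⟨b, φ₁, h, -⟩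
  all_goals
    have hs := h.shape_eq
    simp only [shape_atomT, shape_ttT, shape_andT, shape_impT, shape_allT, reduceCtorEq,
      HeadShape.atom.injEq, Tm.cls_eq] at hs
  exact ⟨a', hs, h'⟩

theorem Translates.inv_ttT {φ : OForm S ℕ []} (h : Translates ttT φ) : φ = .top := by
  rcases h.inv with ⟨a', h, -⟩ | ⟨-, h'⟩ | ⟨b, c, φ₁, φ₂, h, -⟩ | ⟨a, b, φ₁, h, -⟩ | ⟨b, φ₁, h, -⟩
  case inr.inl => exact h'
  all_goals
    have hs := h.shape_eq
    simp only [shape_atomT, shape_ttT, shape_andT, shape_impT, shape_allT, reduceCtorEq] at hs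

theorem Translates.inv_andT {b c : Tm S ℕ [] .prp} {φ : OForm S ℕ []}
    (h : Translates (andT b c) φ) :
    ∃ φ₁ φ₂, φ = .and φ₁ φ₂ ∧ Translates b φ₁ ∧ Translates c φ₂ := by
  rcases h.inv with ⟨a', h, -⟩ | ⟨h, -⟩ | ⟨b', c', φ₁, φ₂, h, h', hb, hc⟩ | ⟨a, b, φ₁, h, -⟩ |
    ⟨b, φ₁, h, -⟩
  all_goals
    have hs := h.shape_eq
    simp only [shape_atomT, shape_ttT, shape_andT, shape_impT, shape_allT, reduceCtorEq,
      HeadShape.and.injEq, Tm.cls_eq] at hs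
  exact ⟨φ₁, φ₂, h', hb.conv hs.1, hc.conv hs.2⟩

theorem Translates.inv_impT {a : Tm S ℕ [] .atm} {b : Tm S ℕ [] .prp} {φ : OForm S ℕ []}
    (h : Translates (impT a b) φ) :
    ∃ a' φ₁, a'.Conv a ∧ φ = .imp (OForm.atm a') φ₁ ∧ Translates b φ₁ := by
  rcases h.inv with ⟨a', h, -⟩ | ⟨h, -⟩ | ⟨b', c', φ₁, φ₂, h, -⟩ | ⟨a', b', φ₁, h, h', hb⟩ |
    ⟨b, φ₁, h, -⟩
  all_goals
    have hs := h.shape_eq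
    simp only [shape_atomT, shape_ttT, shape_andT, shape_impT, shape_allT, reduceCtorEq,
      HeadShape.imp.injEq, Tm.cls_eq] at hs
  exact ⟨a', φ₁, hs.1, h', hb.conv hs.2⟩

theorem Translates.inv_allT {b : Tm S ℕ [] (.arr .i .prp)} {φ : OForm S ℕ []}
    (h : Translates (allT b) φ) :
    ∃ b' φ₁, (Tm.lam b').Conv b ∧ φ = .all .i φ₁ ∧ Translates b' φ₁ := by
  rcases h.inv with ⟨a', h, -⟩ | ⟨h, -⟩ | ⟨b', c', φ₁, φ₂, h, -⟩ | ⟨a', b', φ₁, h, -⟩ |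
    ⟨b', φ₁, h, hφ, hb⟩
  all_goals
    have hs := h.shape_eq
    simp only [shape_atomT, shape_ttT, shape_andT, shape_impT, shape_allT, reduceCtorEq,
      HeadShape.all.injEq, Tm.cls_eq] at hs
  exact ⟨_, _, hs, hφ, hb⟩

/-- The term for a list of atoms. -/
def listT : List (Tm S N [] .atm) → Tm S N [] .atmlst
  | [] => nilT
  | a :: l => consT a (listT l)

theorem TranslatesList.exists_list {L : Tm S N [] .atmlst} {M : Multiset (OForm S N [])}
    (h : TranslatesList L M) : ∃ l : List (Tm S N [] .atm),
      (listT l).Conv L ∧ ∀ F, F ∈ M ↔ ∃ a ∈ l, F = OForm.atm a := by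
  induction h with
  | nil => exact ⟨[], .refl _, by simp⟩
  | cons a _ ih =>
    obtain ⟨l, hl, hM⟩ := ih
    exact ⟨a :: l, .app (.refl _) hl, fun F => by simp [hM]⟩
  | conv h _ ih =>
    obtain ⟨l, hl, hM⟩ := ih
    exact ⟨l, hl.trans h, hM⟩

end Translations

/-! ## Closed formulas -/

section Closed
variable {S : Signature.{u}} {P : Type u} {ar : P → List (Ty S.Ground)} {N : Type}

theorem Tm.occurs_rename {σ : Ty S.Ground} {n : N} {Γ : List (Ty S.Ground)} {τ : Ty S.Ground}
    (t : Tm S N Γ τ) : ∀ {Δ : List (Ty S.Ground)} (ρ : ∀ τ : Ty S.Ground, Var Γ τ → Var Δ τ),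
    (t.rename ρ).Occurs σ n ↔ t.Occurs σ n := by
  induction t with
  | bvar | free | const => exact fun _ => Iff.rfl
  | app t t' ih ih' => exact fun ρ => or_congr (ih ρ) (ih' ρ)
  | lam t ih => exact fun ρ => ih _

theorem Assign.not_occurs_lift {σ σ' : Ty S.Ground} {n : N} {Γ Δ : List (Ty S.Ground)}
    {η : Assign S N Γ Δ} (h : ∀ τ x, ¬ (η τ x).Occurs σ n) (τ : Ty S.Ground)
    (x : Var (σ' :: Γ) τ) : ¬ (η.lift σ' τ x).Occurs σ n := by
  cases x with
  | zero => exact id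
  | succ x => exact fun ho => h _ x ((Tm.occurs_rename _ _).1 ho)

theorem Tm.not_occurs_bind {σ : Ty S.Ground} {n : N} {Γ : List (Ty S.Ground)} {τ : Ty S.Ground}
    (t : Tm S Empty Γ τ) : ∀ {Δ : List (Ty S.Ground)} (θ : NameSubst S Empty N Δ)
    {η : Assign S N Γ Δ}, (∀ τ x, ¬ (η τ x).Occurs σ n) → ¬ (t.bind θ η).Occurs σ n := by
  induction t with
  | bvar x => exact fun _ _ h => h _ x
  | free τ n => exact n.elim
  | const => exact fun _ _ _ => id
  | app t t' ih ih' => exact fun θ _ h ho => ho.elim (ih θ h) (ih' θ h)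
  | lam t ih => exact fun θ _ h => ih _ (Assign.not_occurs_lift h)

theorem Tms.not_occurs_bind {σ : Ty S.Ground} {n : N} {Γ Δ τs : List (Ty S.Ground)}
    (ts : Tms S Empty Γ τs) (θ : NameSubst S Empty N Δ) {η : Assign S N Γ Δ}
    (h : ∀ τ x, ¬ (η τ x).Occurs σ n) : ¬ (ts.bind θ η).Occurs σ n := by
  induction ts with
  | nil => exact id
  | cons t ts ih => exact fun ho => ho.elim (t.not_occurs_bind θ h) ih

theorem Form.not_occurs_bind {σ : Ty S.Ground} {n : N} {Γ : List (Ty S.Ground)}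
    (B : Form S ar Empty Γ) : ∀ {Δ : List (Ty S.Ground)} (θ : NameSubst S Empty N Δ)
    {η : Assign S N Γ Δ}, (∀ τ x, ¬ (η τ x).Occurs σ n) → ¬ (B.bind θ η).Occurs σ n := by
  induction B with
  | atom p ts => exact fun θ _ h => ts.not_occurs_bind θ h
  | top | bot => exact fun _ _ _ => id
  | and _ _ ih ih' | or _ _ ih ih' | imp _ _ ih ih' =>
    exact fun θ _ h ho => ho.elim (ih θ h) (ih' θ h)
  | all τ _ ih | ex τ _ ih => exact fun θ _ h => ih _ (Assign.not_occurs_lift h)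

theorem not_occurs_of_mem_theory {T : List (ProgClause S)} {F : OForm S ℕ []} (hF : F ∈ theory T)
    (σ : Ty S.Ground) (n : ℕ) : ¬ F.Occurs σ n := by
  obtain ⟨c, -, rfl⟩ := hF
  exact Form.not_occurs_bind _ _ fun _ x => nomatch x

theorem Entails.inst_close {H : Set (OForm S ℕ [])} :
    (Γ : List (Ty S.Ground)) → (B : OForm S Empty Γ) →
    Entails H ((Form.close Γ B).bind NameSubst.empty Assign.none) →
    ∀ η : Assign S ℕ Γ [], Entails H (B.bind NameSubst.empty η)
  | [], _, h, η => η.eq_none ▸ h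
  | τ :: Γ, B, h, η => by
    -- The head of the context is quantified innermost, so the tail is instantiated before it.
    have h' := (Entails.inst_close Γ (.all τ B) h fun τ x => η τ (.succ x)).allE (η _ .zero)
    rwa [Form.bind_lift_inst, Assign.cons_head_tail] at h'

theorem Entails.inst_theory {H : Set (OForm S ℕ [])} {T : List (ProgClause S)}
    {c : ProgClause S} (hc : c ∈ T) (hH : theory T ⊆ H) (η : Assign S ℕ c.ctx [])
    (h : Entails H (c.transG.bind NameSubst.empty η)) :
    Entails H (OForm.atm (c.A.bind NameSubst.empty η)) := by
  have hT : Entails H c.toForm := .hyp (hH ⟨c, hc, rfl⟩)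
  have e : c.toForm = (Form.close c.ctx (.imp c.transG (OForm.atm c.A))).bind
      NameSubst.empty Assign.none := by
    rw [ProgClause.toForm, Form.ofClosed, Assign.eq_none fun _ x => .bvar x]; rfl
  rw [e] at hT
  exact (Entails.inst_close _ _ hT η).impE h

end Closed

/-! ## Truth of the encoding implies consequence in the object logic -/

section Extraction
variable {S : Signature.{u}} {T : List (ProgClause S)} {E D : Set (Clause S)}

/-- The extension `E` adds no clauses for `seq`, so a true `seq` atom comes from one of the six
known clauses. The next two lemmas do the same for `element` and `prog`. -/
theorem mem_defIntuit_of_pred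
    (hD : D = defNat S ∪ defList S ∪ defIntuit S ∪ defProg T ∪ E)
    (hE : ∀ c ∈ E, c.pred ≠ .nat ∧ c.pred ≠ .seq ∧ c.pred ≠ .element ∧ c.pred ≠ .prog)
    {c : Clause S} (hc : c ∈ D) (hp : c.pred = .seq) : c ∈ defIntuit S := by
  rw [hD] at hc
  rcases hc with (((hc | hc) | hc) | ⟨d, -, rfl⟩) | hc
  · simp only [defNat, Set.mem_insert_iff, Set.mem_singleton_iff] at hc
    rcases hc with rfl | rfl | rfl | rfl | rfl | rfl | rfl <;> cases hp
  · simp only [defList, Set.mem_insert_iff, Set.mem_singleton_iff] at hc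
    rcases hc with rfl | rfl | rfl | rfl | rfl | rfl | rfl | rfl | rfl | rfl <;> cases hp
  · exact hc
  · cases hp
  · exact absurd hp (hE c hc).2.1

theorem mem_defList_of_pred
    (hD : D = defNat S ∪ defList S ∪ defIntuit S ∪ defProg T ∪ E)
    (hE : ∀ c ∈ E, c.pred ≠ .nat ∧ c.pred ≠ .seq ∧ c.pred ≠ .element ∧ c.pred ≠ .prog)
    {c : Clause S} (hc : c ∈ D) (hp : c.pred = .element) : c ∈ defList S := by
  rw [hD] at hc
  rcases hc with (((hc | hc) | hc) | ⟨d, -, rfl⟩) | hc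
  · simp only [defNat, Set.mem_insert_iff, Set.mem_singleton_iff] at hc
    rcases hc with rfl | rfl | rfl | rfl | rfl | rfl | rfl <;> cases hp
  · exact hc
  · simp only [defIntuit, Set.mem_insert_iff, Set.mem_singleton_iff] at hc
    rcases hc with rfl | rfl | rfl | rfl | rfl | rfl <;> cases hp
  · cases hp
  · exact absurd hp (hE c hc).2.2.1

theorem mem_defProg_of_pred
    (hD : D = defNat S ∪ defList S ∪ defIntuit S ∪ defProg T ∪ E)
    (hE : ∀ c ∈ E, c.pred ≠ .nat ∧ c.pred ≠ .seq ∧ c.pred ≠ .element ∧ c.pred ≠ .prog)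
    {c : Clause S} (hc : c ∈ D) (hp : c.pred = .prog) : c ∈ defProg T := by
  rw [hD] at hc
  rcases hc with (((hc | hc) | hc) | hc) | hc
  · simp only [defNat, Set.mem_insert_iff, Set.mem_singleton_iff] at hc
    rcases hc with rfl | rfl | rfl | rfl | rfl | rfl | rfl <;> cases hp
  · simp only [defList, Set.mem_insert_iff, Set.mem_singleton_iff] at hc
    rcases hc with rfl | rfl | rfl | rfl | rfl | rfl | rfl | rfl | rfl | rfl <;> cases hp
  · simp only [defIntuit, Set.mem_insert_iff, Set.mem_singleton_iff] at hc
    rcases hc with rfl | rfl | rfl | rfl | rfl | rfl <;> cases hp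
  · exact hc
  · exact absurd hp (hE c hc).2.2.2

theorem Tms.Conv.inv_cons {N : Type} {Γ τs : List (Ty S.Ground)} {τ : Ty S.Ground}
    {t t' : Tm S N Γ τ} {ts ts' : Tms S N Γ τs} (h : (Tms.cons t ts).Conv (.cons t' ts')) :
    t.Conv t' ∧ ts.Conv ts' := by
  cases h with | cons h h' => exact ⟨h, h'⟩

theorem seqF_conv {N : Type} {Γ : List (Ty S.Ground)} {n n' : Tm S N Γ .nt}
    {l l' : Tm S N Γ .atmlst} {b b' : Tm S N Γ .prp} (h : (seqF n l b).Conv (seqF n' l' b')) :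
    n.Conv n' ∧ l.Conv l' ∧ b.Conv b' :=
  ⟨h.args.inv_cons.1, h.args.inv_cons.2.inv_cons.1, h.args.inv_cons.2.inv_cons.2.inv_cons.1⟩

theorem elementF_conv {N : Type} {Γ : List (Ty S.Ground)} {a a' : Tm S N Γ .atm}
    {l l' : Tm S N Γ .atmlst} (h : (elementF a l).Conv (elementF a' l')) :
    a.Conv a' ∧ l.Conv l' :=
  ⟨h.args.inv_cons.1, h.args.inv_cons.2.inv_cons.1⟩

theorem progF_conv {N : Type} {Γ : List (Ty S.Ground)} {a a' : Tm S N Γ .atm}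
    {b b' : Tm S N Γ .prp} (h : (progF a b).Conv (progF a' b')) : a.Conv a' ∧ b.Conv b' :=
  ⟨h.args.inv_cons.1, h.args.inv_cons.2.inv_cons.1⟩

theorem consT_conv {a a' : Tm S ℕ [] .atm} {l l' : Tm S ℕ [] .atmlst}
    (h : (consT a l).Conv (consT a' l')) : a.Conv a' ∧ l.Conv l' := by
  simpa only [shape_consT, HeadShape.cons.injEq, Tm.cls_eq] using h.shape_eq

theorem exists_num_of_conv_sucT {n : ℕ} {t : Tm S ℕ [] .nt} (h : (num n).Conv (sucT t)) :
    ∃ m, n = m + 1 ∧ (num m).Conv t := by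
  cases n with
  | zero => exact absurd h.shape_eq (by rw [shape_sucT]; exact fun h => nomatch h)
  | succ m =>
    refine ⟨m, rfl, ?_⟩
    simpa only [num, shape_sucT, HeadShape.suc.injEq, Tm.cls_eq] using h.shape_eq

variable {I : Interp S (Pred.arity (S := S))}

/-- The induction is on the list and not on the truth of the atom, so an arbitrary fixed point of
the definition is good enough. -/
theorem exists_mem_of_model_element
    (hD : D = defNat S ∪ defList S ∪ defIntuit S ∪ defProg T ∪ E)
    (hE : ∀ c ∈ E, c.pred ≠ .nat ∧ c.pred ≠ .seq ∧ c.pred ≠ .element ∧ c.pred ≠ .prog)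
    (hI : ∀ p us, I p us ↔ definitionStep D I p us) (l : List (Tm S ℕ [] .atm)) :
    ∀ {L : Tm S ℕ [] .atmlst} {a : Tm S ℕ [] .atm}, (listT l).Conv L →
    I .element (.cons a (.cons L .nil)) → ∃ a' ∈ l, a'.Conv a := by
  induction l with
  | nil =>
    intro L a hL h
    obtain ⟨c, hc, η, hη, -⟩ := (model_defined_iff hI (by simp) _).1 h
    have hc' := mem_defList_of_pred hD hE hc hη.pred_eq.symm
    simp only [defList, Set.mem_insert_iff, Set.mem_singleton_iff] at hc'
    rcases hc' with rfl | rfl | rfl | rfl | rfl | rfl | rfl | rfl | rfl | rfl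
    -- Both clauses for `element` have a nonempty list in the head, which is not convertible to
    -- `nil`.
    case inr.inr.inr.inl | inr.inr.inr.inr.inl =>
      exact absurd (hL.trans (elementF_conv hη).2).shape_eq
        (by rw [listT, shape_nilT]; exact fun h => nomatch h.trans (shape_consT _ _))
    all_goals cases hη.pred_eq
  | cons a₀ l ih =>
    intro L a hL h
    obtain ⟨c, hc, η, hη, hB⟩ := (model_defined_iff hI (by simp) _).1 h
    have hc' := mem_defList_of_pred hD hE hc hη.pred_eq.symm
    simp only [defList, Set.mem_insert_iff, Set.mem_singleton_iff] at hc'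
    rcases hc' with rfl | rfl | rfl | rfl | rfl | rfl | rfl | rfl | rfl | rfl
    case inr.inr.inr.inl =>
      have h' := elementF_conv (a' := η _ .zero) (l' := consT (η _ .zero) (η _ (.succ .zero))) hη
      exact ⟨a₀, List.mem_cons_self, (consT_conv (hL.trans h'.2)).1.trans h'.1.symm⟩
    case inr.inr.inr.inr.inl =>
      have h' := elementF_conv (a' := η _ .zero)
        (l' := consT (η _ (.succ .zero)) (η _ (.succ (.succ .zero)))) hη
      obtain ⟨a', ha', h⟩ := ih (consT_conv (hL.trans h'.2)).2 hB
      exact ⟨a', List.mem_cons_of_mem _ ha', h.trans h'.1.symm⟩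
    all_goals cases hη.pred_eq

theorem exists_prog_of_model_prog
    (hD : D = defNat S ∪ defList S ∪ defIntuit S ∪ defProg T ∪ E)
    (hE : ∀ c ∈ E, c.pred ≠ .nat ∧ c.pred ≠ .seq ∧ c.pred ≠ .element ∧ c.pred ≠ .prog)
    (hI : ∀ p us, I p us ↔ definitionStep D I p us) {a : Tm S ℕ [] .atm} {b : Tm S ℕ [] .prp}
    (h : I .prog (.cons a (.cons b .nil))) :
    ∃ c ∈ T, ∃ η : Assign S ℕ c.ctx [],
      a.Conv (c.A.bind NameSubst.empty η) ∧ b.Conv (c.G.bind NameSubst.empty η) := by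
  obtain ⟨c, hc, η, hη, -⟩ := (model_defined_iff hI (by simp) _).1 h
  obtain ⟨d, hd, rfl⟩ := mem_defProg_of_pred hD hE hc hη.pred_eq.symm
  exact ⟨d, hd, η, progF_conv hη⟩

/-- The atoms of a list together with the object-level theory. -/
def hyps (T : List (ProgClause S)) (l : List (Tm S ℕ [] .atm)) : Set (OForm S ℕ []) :=
  {F | ∃ a ∈ l, F = OForm.atm a} ∪ theory T

theorem hyps_cons (a : Tm S ℕ [] .atm) (l : List (Tm S ℕ [] .atm)) :
    hyps T (a :: l) = insert (OForm.atm a) (hyps T l) := by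
  ext F
  simp only [hyps, Set.mem_union, Set.mem_ofPred_eq, Set.mem_insert_iff, List.mem_cons,
    exists_eq_or_imp, or_assoc]

/-- The formulas of the theory are closed, so only the finitely many atoms of `l` and the formula
`B` restrict the choice. -/
theorem exists_fresh (T : List (ProgClause S)) (l : List (Tm S ℕ [] .atm))
    (B : OForm S ℕ [.i]) : ∃ y, (∀ F ∈ hyps T l, ¬ F.Occurs .i y) ∧ ¬ B.Occurs .i y := by
  obtain ⟨k, hk⟩ := exists_bound_occurs (↑(l.map OForm.atm) : Multiset (OForm S ℕ []))
  obtain ⟨k', hk'⟩ := B.exists_bound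
  refine ⟨max k k', ?_, fun ho => absurd (hk' _ _ ho) (by simp)⟩
  rintro F (⟨a, ha, rfl⟩ | hF)
  · exact fun ho => absurd (hk _ (by simpa using ⟨a, ha, rfl⟩) _ _ ho) (by simp)
  · exact not_occurs_of_mem_theory hF _ _

/-- The numeral bounds the depth of unfolding: every clause that calls `seq` again has a successor
in its head. The terms, list and goal are generalized because each clause matches them only up to
conversion. -/
theorem entails_of_model_seq
    (hD : D = defNat S ∪ defList S ∪ defIntuit S ∪ defProg T ∪ E)
    (hE : ∀ c ∈ E, c.pred ≠ .nat ∧ c.pred ≠ .seq ∧ c.pred ≠ .element ∧ c.pred ≠ .prog)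
    (hI : ∀ p us, I p us ↔ definitionStep D I p us) (n : ℕ) :
    ∀ {t : Tm S ℕ [] .nt} {l : List (Tm S ℕ [] .atm)} {L : Tm S ℕ [] .atmlst}
      {B : Tm S ℕ [] .prp} {φ : OForm S ℕ []},
    (num n).Conv t → (listT l).Conv L → Translates B φ →
    I .seq (.cons t (.cons L (.cons B .nil))) → Entails (hyps T l) φ := by
  induction n using Nat.strong_induction_on with
  | _ n ih =>
  intro t l L B φ ht hL hB h
  obtain ⟨c, hc, η, hη, hbody⟩ := (model_defined_iff hI (by simp) _).1 h
  have hc' := mem_defIntuit_of_pred hD hE hc hη.pred_eq.symm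
  simp only [defIntuit, Set.mem_insert_iff, Set.mem_singleton_iff] at hc'
  rcases hc' with rfl | rfl | rfl | rfl | rfl | rfl
  · obtain ⟨-, hL', hB'⟩ := seqF_conv (n' := η _ .zero)
      (l' := consT (η _ (.succ .zero)) (η _ (.succ (.succ .zero))))
      (b' := atomT (η _ (.succ (.succ (.succ .zero))))) hη
    obtain ⟨a', ha', rfl⟩ := (hB.conv hB').inv_atomT
    obtain ⟨a, ha, haa⟩ := exists_mem_of_model_element hD hE hI l (hL.trans hL') hbody
    exact (Entails.hyp (.inl ⟨a, ha, rfl⟩)).conv (.atom _ (.cons (haa.trans ha'.symm) .nil))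
  · obtain ⟨-, -, hB'⟩ := seqF_conv (n' := η _ .zero) (l' := η _ (.succ .zero)) (b' := ttT) hη
    rw [(hB.conv hB').inv_ttT]
    exact .topI
  · obtain ⟨ht', hL', hB'⟩ := seqF_conv (n' := sucT (η _ .zero)) (l' := η _ (.succ .zero))
      (b' := andT (η _ (.succ (.succ .zero))) (η _ (.succ (.succ (.succ .zero))))) hη
    obtain ⟨m, rfl, hm⟩ := exists_num_of_conv_sucT (ht.trans ht')
    obtain ⟨φ₁, φ₂, rfl, h₁, h₂⟩ := (hB.conv hB').inv_andT
    exact .andI (ih m (Nat.lt_succ_self m) hm (hL.trans hL') h₁ hbody.1)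
      (ih m (Nat.lt_succ_self m) hm (hL.trans hL') h₂ hbody.2)
  · obtain ⟨ht', hL', hB'⟩ := seqF_conv (n' := sucT (η _ .zero)) (l' := η _ (.succ .zero))
      (b' := impT (η _ (.succ (.succ .zero))) (η _ (.succ (.succ (.succ .zero))))) hη
    obtain ⟨m, rfl, hm⟩ := exists_num_of_conv_sucT (ht.trans ht')
    obtain ⟨a, φ₁, ha, rfl, h₁⟩ := (hB.conv hB').inv_impT
    refine .impI ?_
    rw [← hyps_cons]
    exact ih m (Nat.lt_succ_self m) hm (.app (.app (.refl _) ha) (hL.trans hL')) h₁ hbody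
  · obtain ⟨ht', hL', hB'⟩ := seqF_conv (n' := sucT (η _ .zero)) (l' := η _ (.succ .zero))
      (b' := allT (η _ (.succ (.succ .zero)))) hη
    obtain ⟨m, rfl, hm⟩ := exists_num_of_conv_sucT (ht.trans ht')
    obtain ⟨b, φ₁, hb, rfl, h₁⟩ := (hB.conv hB').inv_allT
    -- The body holds in the model at every open term, in particular at a fresh variable, which
    -- serves as the eigenvariable.
    obtain ⟨y, hy, hy'⟩ := exists_fresh T l φ₁
    refine .allI y hy hy' (ih m (Nat.lt_succ_self m) hm (hL.trans hL') ?_ (hbody (.free .i y)))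
    exact (h₁.bind _ _).conv ((Tm.Conv.beta b (.free .i y)).symm.trans (hb.app (.refl _)))
  · obtain ⟨ht', hL', hB'⟩ := seqF_conv (n' := sucT (η _ .zero)) (l' := η _ (.succ .zero))
      (b' := atomT (η _ (.succ (.succ .zero)))) hη
    obtain ⟨m, rfl, hm⟩ := exists_num_of_conv_sucT (ht.trans ht')
    obtain ⟨a, ha, rfl⟩ := (hB.conv hB').inv_atomT
    obtain ⟨b, hprog, hseq⟩ := hbody
    obtain ⟨c, hc, η', hA, hG⟩ := exists_prog_of_model_prog hD hE hI hprog
    -- The formula `c.transG` under `η'` translates the goal found by backchaining; the theory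
    -- formula then leads from it to the atom.
    have hG' := ih m (Nat.lt_succ_self m) hm (hL.trans hL')
      ((c.translates.bind NameSubst.empty η').conv hG.symm) hseq
    exact (Entails.inst_theory hc Set.subset_union_right η' hG').conv
      (.atom _ (.cons (hA.symm.trans ha.symm) .nil))

theorem entails_of_derivable
    (hD : D = defNat S ∪ defList S ∪ defIntuit S ∪ defProg T ∪ E)
    (hE : ∀ c ∈ E, c.pred ≠ .nat ∧ c.pred ≠ .seq ∧ c.pred ≠ .element ∧ c.pred ≠ .prog)
    {lvl : Pred S → ℕ} (hlvl : ∀ c ∈ D, c.body.level lvl ≤ lvl c.pred)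
    {l : List (Tm S ℕ [] .atm)} {L : Tm S ℕ [] .atmlst} {B : Tm S ℕ [] .prp} {φ : OForm S ℕ []}
    (hL : (listT l).Conv L) (hB : Translates B φ) (h : Derivable D 0 (prv L B)) :
    Entails (hyps T l) φ := by
  obtain ⟨I, hI⟩ := exists_model hlvl
  obtain ⟨t, hnat, hseq⟩ := h.sound hI (fun τ n => .free τ n)
    fun F hF => absurd hF (Multiset.notMem_zero F)
  obtain ⟨n, hn⟩ := (model_nat_iff hI _).1 hnat
  have e : ∀ {τ : Ty S.Ground} (r : Tm S ℕ [] τ),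
      r.wk.bind (fun τ n => .free τ n) (Assign.cons t Assign.none) = r :=
    fun r => (Tm.bind_wk _ _ _ _).trans r.bind_id_none
  refine entails_of_model_seq hD hE hI n hn.symm (hL.trans ?_)
    (B := B.wk.bind (fun τ n => .free τ n) (Assign.cons t Assign.none)) ?_ hseq
  · rw [e]; exact .refl _
  · rwa [e]

end Extraction

/-! ## Soundness of the object logic in Kripke structures -/

/-- Constant domains validate more than intuitionistic logic proves, but soundness is all that is
used. -/
theorem Entails.sound {S : Signature.{u}} {W : Type u} [Preorder W] {I : W → Interp S (objArity S)}
    (hmono : ∀ w w', w ≤ w' → ∀ p ts, I w p ts → I w' p ts)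
    (hc : ∀ w p ts ts', Tms.Conv ts ts' → I w p ts → I w p ts')
    {H : Set (OForm S ℕ [])} {A : OForm S ℕ []} (h : Entails H A) :
    ∀ (θ : NameSubst S ℕ ℕ []) (w : W), (∀ F ∈ H, F.Forces I θ Assign.none w) →
      A.Forces I θ Assign.none w := by
  induction h with
  | hyp h => exact fun θ w hH => hH _ h
  | conv h _ ih => exact fun θ w hH => (h.forces_iff hc).1 (ih θ w hH)
  | topI => exact fun _ _ _ => trivial
  | botE _ ih => exact fun θ w hH => (ih θ w hH).elim
  | andI _ _ ih ih' => exact fun θ w hH => ⟨ih θ w hH, ih' θ w hH⟩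
  | andE₁ _ ih => exact fun θ w hH => (ih θ w hH).1
  | andE₂ _ ih => exact fun θ w hH => (ih θ w hH).2
  | orI₁ _ ih => exact fun θ w hH => .inl (ih θ w hH)
  | orI₂ _ ih => exact fun θ w hH => .inr (ih θ w hH)
  | orE _ _ _ ih ih₁ ih₂ =>
    intro θ w hH
    exact (ih θ w hH).elim (fun h => ih₁ θ w (Set.forall_mem_insert.2 ⟨h, hH⟩))
      fun h => ih₂ θ w (Set.forall_mem_insert.2 ⟨h, hH⟩)
  | impI _ ih =>
    exact fun θ w hH w' hw h => ih θ w' (Set.forall_mem_insert.2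
      ⟨h, fun F hF => (hH F hF).mono hmono hw⟩)
  | impE _ _ ih ih' => exact fun θ w hH => ih θ w hH w le_rfl (ih' θ w hH)
  | allI y hy hB _ ih =>
    exact fun θ w hH t => (Form.forces_inst_update hB θ t).1
      (ih _ w fun F hF => (Form.forces_update (hy F hF) θ t).2 (hH F hF))
  | allE t _ ih => exact fun θ w hH => (Form.forces_inst _ t θ _ w).2 (ih θ w hH _)
  | exI t _ ih => exact fun θ w hH => ⟨_, (Form.forces_inst _ t θ _ w).1 (ih θ w hH)⟩
  | exE y hy hB hC _ _ ih ih' =>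
    intro θ w hH
    obtain ⟨t, ht⟩ := ih θ w hH
    exact (Form.forces_update hC θ t).1 (ih' _ w (Set.forall_mem_insert.2
      ⟨(Form.forces_inst_update hB θ t).2 ht,
        fun F hF => (Form.forces_update (hy F hF) θ t).2 (hH F hF)⟩))

/-! ## Goal-directed proofs -/

section Uniform
variable {S : Signature.{u}} {T : List (ProgClause S)}

/-- `Uniform T n l B`: the goal `B` has a goal-directed proof of height at most `n` from the atoms
in `l` and the theory `T`. -/
inductive Uniform (T : List (ProgClause S)) :
    ℕ → List (Tm S ℕ [] .atm) → Tm S ℕ [] .prp → Prop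
  | hyp {n : ℕ} {l : List (Tm S ℕ [] .atm)} {a a' : Tm S ℕ [] .atm} {B : Tm S ℕ [] .prp} :
      a' ∈ l → a'.Conv a → (atomT a).Conv B → Uniform T n l B
  | tt {n : ℕ} {l : List (Tm S ℕ [] .atm)} {B : Tm S ℕ [] .prp} :
      ttT.Conv B → Uniform T n l B
  | and {n : ℕ} {l : List (Tm S ℕ [] .atm)} {b c B : Tm S ℕ [] .prp} :
      (andT b c).Conv B → Uniform T n l b → Uniform T n l c → Uniform T (n + 1) l B
  | imp {n : ℕ} {l : List (Tm S ℕ [] .atm)} {a : Tm S ℕ [] .atm} {b B : Tm S ℕ [] .prp} :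
      (impT a b).Conv B → Uniform T n (a :: l) b → Uniform T (n + 1) l B
  -- One height serves all instances, since the clause for the quantifier passes the same `I` to
  -- each of them.
  | all {n : ℕ} {l : List (Tm S ℕ [] .atm)} {b : Tm S ℕ [] (.arr .i .prp)} {B : Tm S ℕ [] .prp} :
      (allT b).Conv B → (∀ t, Uniform T n l (.app b t)) → Uniform T (n + 1) l B
  | prog {n : ℕ} {l : List (Tm S ℕ [] .atm)} {B : Tm S ℕ [] .prp} {c : ProgClause S}
      (η : Assign S ℕ c.ctx []) : c ∈ T → (atomT (c.A.bind NameSubst.empty η)).Conv B →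
      Uniform T n l (c.G.bind NameSubst.empty η) → Uniform T (n + 1) l B

theorem Uniform.conv {n : ℕ} {l : List (Tm S ℕ [] .atm)} {B B' : Tm S ℕ [] .prp}
    (h : Uniform T n l B) (hB : B.Conv B') : Uniform T n l B' := by
  cases h with
  | hyp h h' h'' => exact .hyp h h' (h''.trans hB)
  | tt h => exact .tt (h.trans hB)
  | and h h₁ h₂ => exact .and (h.trans hB) h₁ h₂
  | imp h h₁ => exact .imp (h.trans hB) h₁
  | all h h₁ => exact .all (h.trans hB) h₁
  | prog η hc h h₁ => exact .prog η hc (h.trans hB) h₁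

theorem Uniform.mono {n : ℕ} {l : List (Tm S ℕ [] .atm)} {B : Tm S ℕ [] .prp}
    (h : Uniform T n l B) : ∀ {m : ℕ} {l' : List (Tm S ℕ [] .atm)}, n ≤ m → l ⊆ l' →
    Uniform T m l' B := by
  induction h with
  | hyp h h' h'' => exact fun _ hl => .hyp (hl h) h' h''
  | tt h => exact fun _ _ => .tt h
  | and h _ _ ih ih' =>
    intro m l' hn hl
    obtain ⟨m, rfl⟩ := Nat.exists_eq_add_one_of_ne_zero (Nat.ne_zero_of_lt hn)
    exact .and h (ih (by omega) hl) (ih' (by omega) hl)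
  | imp h _ ih =>
    intro m l' hn hl
    obtain ⟨m, rfl⟩ := Nat.exists_eq_add_one_of_ne_zero (Nat.ne_zero_of_lt hn)
    exact .imp h (ih (by omega) (List.cons_subset_cons _ hl))
  | all h _ ih =>
    intro m l' hn hl
    obtain ⟨m, rfl⟩ := Nat.exists_eq_add_one_of_ne_zero (Nat.ne_zero_of_lt hn)
    exact .all h fun t => ih t (by omega) hl
  | prog η hc h _ ih =>
    intro m l' hn hl
    obtain ⟨m, rfl⟩ := Nat.exists_eq_add_one_of_ne_zero (Nat.ne_zero_of_lt hn)
    exact .prog η hc h (ih (by omega) hl)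

theorem exists_fresh_atoms (l : List (Tm S ℕ [] .atm)) {τ : Ty S.Ground} (b : Tm S ℕ [] τ)
    (σ : Ty S.Ground) : ∃ y, (∀ a ∈ l, ¬ a.Occurs σ y) ∧ ¬ b.Occurs σ y := by
  obtain ⟨k, hk⟩ := exists_bound_occurs (↑(l.map OForm.atm) : Multiset (OForm S ℕ []))
  obtain ⟨k', hk'⟩ := b.exists_bound
  refine ⟨max k k', fun a ha ho => ?_, fun ho => absurd (hk' _ _ ho) (by simp)⟩
  exact absurd (hk (OForm.atm a) (by simpa using ⟨a, ha, rfl⟩) _ _ (.inl ho)) (by simp)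

theorem map_bind_update {l : List (Tm S ℕ [] .atm)} {σ : Ty S.Ground} {y : ℕ}
    (h : ∀ a ∈ l, ¬ a.Occurs σ y) (θ : NameSubst S ℕ ℕ []) (r : Tm S ℕ [] σ) :
    l.map (Tm.bind (θ.update σ y r) Assign.none) = l.map (Tm.bind θ Assign.none) :=
  List.map_congr_left fun a ha => a.bind_update_of_not_occurs (h a ha) θ r _

/-- Substitution preserves the height. This is what turns one generic instance into all instances
with a common bound. -/
theorem Uniform.bind {n : ℕ} {l : List (Tm S ℕ [] .atm)} {B : Tm S ℕ [] .prp}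
    (h : Uniform T n l B) : ∀ θ : NameSubst S ℕ ℕ [],
    Uniform T n (l.map (Tm.bind θ Assign.none)) (B.bind θ Assign.none) := by
  induction h with
  | hyp h h' h'' =>
    exact fun θ => .hyp (List.mem_map_of_mem h) (h'.bind θ _) (h''.bind θ _)
  | tt h => exact fun θ => .tt (h.bind θ _)
  | and h _ _ ih ih' => exact fun θ => .and (h.bind θ _) (ih θ) (ih' θ)
  | imp h _ ih => exact fun θ => .imp (h.bind θ _) (ih θ)
  | @all n l b B h _ ih =>
    intro θ
    obtain ⟨y, hl, hb⟩ := exists_fresh_atoms l b .i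
    refine .all (h.bind θ _) fun t => ?_
    -- The premises are instances of `b` before the substitution. The one at a fresh `y`, with `y`
    -- then sent to `t`, becomes the required instance after it.
    have := ih (.free .i y) (θ.update .i y t)
    rwa [map_bind_update hl, Tm.bind, b.bind_update_of_not_occurs hb, Tm.bind,
      NameSubst.update_same] at this
  | @prog n l B c η hc h _ ih =>
    intro θ
    have e : ∀ {τ : Ty S.Ground} (t : Tm S Empty c.ctx τ),
        (t.bind NameSubst.empty η).bind θ Assign.none =
          t.bind NameSubst.empty fun τ x => (η τ x).bind θ Assign.none := by
      intro τ t
      rw [Tm.bind_bind, NameSubst.eq_empty fun τ n => _]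
    refine .prog (fun τ x => (η τ x).bind θ Assign.none) hc ?_ ?_
    · rw [← e]
      exact h.bind θ _
    · rw [← e]
      exact ih θ

theorem Uniform.forall_of_fresh {n : ℕ} {l : List (Tm S ℕ [] .atm)}
    {b : Tm S ℕ [] (.arr .i .prp)} {y : ℕ} (hl : ∀ a ∈ l, ¬ a.Occurs .i y) (hb : ¬ b.Occurs .i y)
    (h : Uniform T n l (.app b (.free .i y))) (t : Tm S ℕ [] .i) : Uniform T n l (.app b t) := by
  have := h.bind (NameSubst.update (fun τ n => .free τ n) .i y t)
  rw [map_bind_update hl, Tm.bind, b.bind_update_of_not_occurs hb, Tm.bind,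
    NameSubst.update_same, b.bind_id_none] at this
  rwa [List.map_congr_left fun a _ => a.bind_id_none, List.map_id'] at this

/-! ### The Kripke structure of goal-directed provability -/

/-- The worlds: lists of atoms, ordered by inclusion. -/
structure World (S : Signature.{u}) : Type u where
  atoms : List (Tm S ℕ [] .atm)

instance : Preorder (World S) where
  le w w' := w.atoms ⊆ w'.atoms
  le_refl w := List.Subset.refl _
  le_trans _ _ _ := List.Subset.trans

/-- An atom is forced at a world if it has a goal-directed proof. -/
def provInterp (T : List (ProgClause S)) (w : World S) : Interp S (objArity S) :=
  fun _ (ts : Tms S ℕ [] [.atm]) =>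
    match ts with
    | .cons a .nil => ∃ n, Uniform T n w.atoms (atomT a)

theorem provInterp_mono (w w' : World S) (h : w ≤ w') (p : PUnit)
    (ts : Tms S ℕ [] (objArity S p)) (ht : provInterp T w p ts) : provInterp T w' p ts := by
  change Tms S ℕ [] [.atm] at ts
  match ts, ht with
  | .cons a .nil, ⟨n, hn⟩ => exact ⟨n, hn.mono le_rfl h⟩

theorem provInterp_conv (w : World S) (p : PUnit) (ts ts' : Tms S ℕ [] (objArity S p))
    (h : ts.Conv ts') (ht : provInterp T w p ts) : provInterp T w p ts' := by
  change Tms S ℕ [] [.atm] at ts ts'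
  match ts, ts', h, ht with
  | .cons a .nil, .cons a' .nil, .cons h _, ⟨n, hn⟩ => exact ⟨n, hn.conv (.app (.refl _) h)⟩

/-- The converse is not needed: goals occur only as the conclusion and as premises of theory
formulas, and in both places forcing is what is given. -/
theorem Translates.exists_uniform {N : Type} {Γ : List (Ty S.Ground)} {B : Tm S N Γ .prp}
    {φ : OForm S N Γ} (h : Translates B φ) {θ : NameSubst S N ℕ []} :
    ∀ {η : Assign S ℕ Γ []} {w : World S}, φ.Forces (provInterp T) θ η w →
      ∃ n, Uniform T n w.atoms (B.bind θ η) := by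
  induction h with
  | atom a => exact fun h => h
  | tt => exact fun _ => ⟨0, .tt (.refl _)⟩
  | and _ _ ih ih' =>
    intro η w h
    obtain ⟨n, hn⟩ := ih h.1
    obtain ⟨n', hn'⟩ := ih' h.2
    exact ⟨max n n' + 1, .and (.refl _) (hn.mono (le_max_left _ _) (List.Subset.refl _))
      (hn'.mono (le_max_right _ _) (List.Subset.refl _))⟩
  | imp a _ ih =>
    intro η w h
    -- The antecedent is an atom, so it is forced as soon as it joins the list of the world.
    obtain ⟨n, hn⟩ := ih (h ⟨a.bind θ η :: w.atoms⟩ (List.subset_cons_self _ _)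
      ⟨0, .hyp List.mem_cons_self (.refl _) (.refl _)⟩)
    exact ⟨n + 1, .imp (.refl _) hn⟩
  | @all Γ b φ _ ih =>
    intro η w h
    -- Forcing gives each instance a height of its own. The proof for a fresh variable provides one
    -- height for all of them.
    obtain ⟨y, hl, hb⟩ := exists_fresh_atoms w.atoms ((Tm.lam b).bind θ η) .i
    obtain ⟨n, hn⟩ := ih (h (.free .i y))
    refine ⟨n + 1, .all (.refl _) (Uniform.forall_of_fresh hl hb (hn.conv ?_))⟩
    rw [← Tm.bind_lift_inst]
    exact (Tm.Conv.beta _ _).symm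
  | conv h _ ih =>
    intro η w hφ
    obtain ⟨n, hn⟩ := ih hφ
    exact ⟨n, hn.conv (h.bind θ η)⟩

theorem Form.forces_close {P : Type u} {ar : P → List (Ty S.Ground)} {W : Type u} [Preorder W]
    {I : W → Interp S ar} {N : Type} {θ : NameSubst S N ℕ []} {w : W} :
    (Γ : List (Ty S.Ground)) → (B : Form S ar N Γ) → (∀ η, B.Forces I θ η w) →
    (Form.close Γ B).Forces I θ Assign.none w
  | [], _, h => h _
  | τ :: Γ, B, h => Form.forces_close Γ (.all τ B) fun _ _ => h _

/-- If the premise of a program clause is forced, it has a goal-directed proof, and one backchaining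
step proves the head. -/
theorem forces_of_mem_theory {F : OForm S ℕ []} (hF : F ∈ theory T) (θ : NameSubst S ℕ ℕ [])
    (w : World S) : F.Forces (provInterp T) θ Assign.none w := by
  obtain ⟨c, hc, rfl⟩ := hF
  rw [ProgClause.toForm, Form.ofClosed, Form.forces_bind, Assign.eq_none fun τ x => _,
    NameSubst.eq_empty fun τ n => _]
  refine Form.forces_close _ _ fun η w' _ h => ?_
  obtain ⟨n, hn⟩ := c.translates.exists_uniform h
  exact ⟨n + 1, .prog η hc (.refl _) hn⟩

theorem Entails.exists_uniform {l : List (Tm S ℕ [] .atm)} {B : Tm S ℕ [] .prp}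
    {φ : OForm S ℕ []} (hB : Translates B φ) (h : Entails (hyps T l) φ) :
    ∃ n, Uniform T n l B := by
  have hφ := h.sound (I := provInterp T) provInterp_mono provInterp_conv (fun τ n => .free τ n) ⟨l⟩
    (by
      rintro F (⟨a, ha, rfl⟩ | hF)
      · refine ⟨0, .hyp ha (.refl a) ?_⟩
        rw [a.bind_id_none]
        exact .refl _
      · exact forces_of_mem_theory hF _ _)
  obtain ⟨n, hn⟩ := hB.exists_uniform hφ
  rw [B.bind_id_none] at hn
  exact ⟨n, hn⟩

end Uniform

/-! ## Goal-directed proofs are derivable in the meta-logic -/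

section Derivability
variable {S : Signature.{u}} {T : List (ProgClause S)} {D : Set (Clause S)}

theorem derivable_natF_num (n : ℕ) : Derivable D 0 (natF (num n)) := by
  induction n with
  | zero => exact .natR_zero
  | succ n ih => exact .natR_suc ih

theorem derivable_elementF (hD : defList S ⊆ D) {a a' : Tm S ℕ [] .atm} (h : a'.Conv a) :
    (l : List (Tm S ℕ [] .atm)) → a' ∈ l → Derivable D 0 (elementF a (listT l))
  | a₀ :: l, hl => by
    rcases List.mem_cons.1 hl with rfl | hl
    · exact .defR .element _ ⟨[.atm, .atmlst], .element, .cons v0 (.cons (consT v0 v1) .nil), .top⟩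
        (Assign.cons a (Assign.cons (listT l) Assign.none)) (by simp)
        (hD (.inr (.inr (.inr (.inl rfl)))))
        (.atom _ (.cons (.refl _) (.cons (.app (.app (.refl _) h) (.refl _)) .nil))) .topR
    · exact .defR .element _ ⟨[.atm, .atm, .atmlst], .element,
          .cons v0 (.cons (consT v1 v2) .nil), elementF v0 v2⟩
        (Assign.cons a (Assign.cons a₀ (Assign.cons (listT l) Assign.none))) (by simp)
        (hD (.inr (.inr (.inr (.inr (.inl rfl))))))
        (.refl _) (derivable_elementF hD h l hl)

theorem derivable_seqF_of_conv {n : Tm S ℕ [] .nt} {l : Tm S ℕ [] .atmlst}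
    {b b' : Tm S ℕ [] .prp} (hb : b.Conv b') (h : Derivable D 0 (seqF n l b)) :
    Derivable D 0 (seqF n l b') :=
  h.conv .zero (.atom _ (.cons (.refl _) (.cons (.refl _) (.cons hb .nil))))

/-- Each rule of `Uniform` is one use of `defR` on the corresponding clause for `seq`, with the
height as the numeral, followed by right rules; the left side stays empty. -/
theorem Uniform.derivable (hL : defList S ⊆ D) (hS : defIntuit S ⊆ D) (hP : defProg T ⊆ D)
    {n : ℕ} {l : List (Tm S ℕ [] .atm)} {B : Tm S ℕ [] .prp} (h : Uniform T n l B) :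
    Derivable D 0 (seqF (num n) (listT l) B) := by
  induction h with
  | @hyp n l a a' B h h' h'' =>
    refine derivable_seqF_of_conv h'' ?_
    match l, h with
    -- The clause for hypotheses requires a nonempty list, which membership guarantees.
    | a₀ :: l, h =>
      refine .defR .seq _ _ (Assign.cons (num n) (Assign.cons a₀
          (Assign.cons (listT l) (Assign.cons a Assign.none)))) (by simp)
        (hS (.inl rfl)) (.refl _) ?_
      exact derivable_elementF hL h' _ h
  | @tt n l B h =>
    exact derivable_seqF_of_conv h (.defR .seq _ _
      (Assign.cons (num n) (Assign.cons (listT l) Assign.none)) (by simp)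
      (hS (.inr (.inl rfl))) (.refl _) .topR)
  | @and n l b c B h _ _ ih ih' =>
    refine derivable_seqF_of_conv h (.defR .seq _ _
      (Assign.cons (num n) (Assign.cons (listT l) (Assign.cons b (Assign.cons c Assign.none))))
      (by simp) (hS (.inr (.inr (.inl rfl)))) (.refl _) ?_)
    exact .andR ih ih'
  | @imp n l a b B h _ ih =>
    refine derivable_seqF_of_conv h (.defR .seq _ _
      (Assign.cons (num n) (Assign.cons (listT l) (Assign.cons a (Assign.cons b Assign.none))))
      (by simp) (hS (.inr (.inr (.inr (.inl rfl))))) (.refl _) ?_)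
    exact ih
  | @all n l b B h _ ih =>
    refine derivable_seqF_of_conv h (.defR .seq _ _
      (Assign.cons (num n) (Assign.cons (listT l) (Assign.cons b Assign.none)))
      (by simp) (hS (.inr (.inr (.inr (.inr (.inl rfl)))))) (.refl _) ?_)
    -- The instantiated clause body with its weakenings made explicit, so that `Tm.wk_inst` cancels
    -- them.
    let C : MForm S ℕ [.i] := seqF (num n).wk (listT l).wk (.app b.wk v0)
    obtain ⟨y, hy⟩ := C.exists_bound
    refine Derivable.allR (B := C) y (fun F hF => absurd hF (Multiset.notMem_zero F))
      (fun ho => absurd (hy _ _ ho) (lt_irrefl _)) ?_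
    have e : C.inst (.free .i y) = seqF (num n) (listT l) (.app b (.free .i y)) := by
      change seqF ((num n).wk.inst _) ((listT l).wk.inst _) (.app (b.wk.inst _) _) = _
      rw [Tm.wk_inst, Tm.wk_inst, Tm.wk_inst]; rfl
    rw [e]
    exact ih _
  | @prog n l B c η hc h _ ih =>
    let a := c.A.bind NameSubst.empty η
    refine derivable_seqF_of_conv h (.defR .seq _ _
      (Assign.cons (num n) (Assign.cons (listT l) (Assign.cons a Assign.none)))
      (by simp) (hS (.inr (.inr (.inr (.inr (.inr rfl)))))) (.refl _) ?_)
    let C : MForm S ℕ [.prp] := .and (progF a.wk v0) (seqF (num n).wk (listT l).wk v0)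
    refine Derivable.exR (B := C) (c.G.bind NameSubst.empty η) ?_
    have e : C.inst (c.G.bind NameSubst.empty η) =
        .and (progF a (c.G.bind NameSubst.empty η))
          (seqF (num n) (listT l) (c.G.bind NameSubst.empty η)) := by
      change Form.and (progF (a.wk.inst _) _) (seqF ((num n).wk.inst _) ((listT l).wk.inst _) _) = _
      rw [Tm.wk_inst, Tm.wk_inst, Tm.wk_inst]; rfl
    rw [e]
    exact .andR (.defR .prog _ c.toClause η (by simp) (hP ⟨c, hc, rfl⟩) (.refl _) .topR) ih

theorem derivable_prv {n : ℕ} {L : Tm S ℕ [] .atmlst} {B : Tm S ℕ [] .prp}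
    (h : Derivable D 0 (seqF (num n) L B)) : Derivable D 0 (prv L B) := by
  refine .exR (num n) ?_
  have e : (Form.and (natF v0) (seqF v0 L.wk B.wk) : MForm S ℕ [.nt]).inst (num n) =
      .and (natF (num n)) (seqF (num n) L B) := by
    change Form.and _ (seqF _ (L.wk.inst _) (B.wk.inst _)) = _
    rw [Tm.wk_inst, Tm.wk_inst]; rfl
  rw [e]
  exact .andR (derivable_natF_num n) h

end Derivability

end FOLambda

/-! ### Adequacy: the two directions combined. -/

theorem mainTheorem1 {S : FOLambda.Signature.{u}}
    (T : List (FOLambda.ProgClause S))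
    (E D : Set (FOLambda.Clause S))
    (hD : D = FOLambda.defNat S ∪ FOLambda.defList S ∪ FOLambda.defIntuit S ∪
      FOLambda.defProg T ∪ E)
    (hE : ∀ c ∈ E, c.pred ≠ .nat ∧ c.pred ≠ .seq ∧ c.pred ≠ .element ∧ c.pred ≠ .prog)
    (lvl : FOLambda.Pred S → ℕ)
    (hlvl : ∀ c ∈ D, c.body.level lvl ≤ lvl c.pred)
    (L : FOLambda.Tm S ℕ [] .atmlst) (M : Multiset (FOLambda.OForm S ℕ []))
    (hL : FOLambda.TranslatesList L M)
    (B : FOLambda.Tm S ℕ [] .prp) (φ : FOLambda.OForm S ℕ [])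
    (hB : FOLambda.Translates B φ) :
    FOLambda.Derivable D 0 (FOLambda.prv L B) ↔
      FOLambda.Entails ({F | F ∈ M} ∪ FOLambda.theory T) φ := by
  obtain ⟨l, hl, hM⟩ := hL.exists_list
  have e : {F | F ∈ M} ∪ FOLambda.theory T = FOLambda.hyps T l :=
    congrArg (· ∪ FOLambda.theory T) (Set.ext hM)
  rw [e]
  constructor
  · exact FOLambda.entails_of_derivable hD hE hlvl hl hB
  · intro h
    obtain ⟨n, hn⟩ := h.exists_uniform hB
    -- The goal-directed proof concerns the canonical list `listT l`; conversion carries the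
    -- derivation over to `L`.
    refine FOLambda.derivable_prv (n := n) ((hn.derivable ?_ ?_ ?_).conv .zero
      (.atom _ (.cons (.refl _) (.cons hl (.cons (.refl _) .nil)))))
    · exact hD ▸ fun _ h => .inl (.inl (.inl (.inr h)))
    · exact hD ▸ fun _ h => .inl (.inl (.inr h))
    · exact hD ▸ fun _ h => .inl (.inr h)
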